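/- Let $\mathbb F$ be a field. Definitions. An arithmetic circuit over $\mathbb F$ and a set $X$ of variables is a finite directed acyclic graph in which every node (gate) either has indegree $0$ and is labelled by an element of $\mathbb F\cup X$, or has indegree $2$ and is labelled by $+$ or $\times$; the gates of indegree $2$ are the operation gates. At every gate the circuit computes a polynomial in $\mathbb F[X]$ in the obvious way, and it computes $f$ if it does so at some gate. Its size is the number of its operation gates. It is multiplicatively disjoint if, for each multiplication gate, the subcircuits rooted at its two children have no gate in common, and it is a formula if every gate has outdegree at most one. $\mathrm{VP}$ (respectively $\mathrm{VF}$) is the class of sequences $(f_n)_{n\in\mathbb N}$ of multivariate polynomials over $\mathbb F$ (each in a finite set of variables that may depend on $n$) for which there are multiplicatively disjoint circuits (respectively formulas) $\Phi_n$ computing $f_n$ whose size is bounded by a polynomial in $n$. $\mathrm{VNP}$ is the class of sequences $(f_n)$ for which there is a sequence $(g_n)$ in $\mathrm{VP}$ such that, for all $n$, $$f_n(x_1,\dots,x_{v(n)})=\sum_{e\in\{0,1\}^{u(n)-v(n)}} g_n(x_1,\dots,x_{v(n)},e_{v(n)+1},\dots,e_{u(n)}).$$ A polynomial $f$ is a projection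 of $g(y_1,\dots,y_m)$ if $f=g(a_1,\dots,a_m)$ where each $a_i$ is an element of $\mathbb F$ or a variable of $f$. A sequence $(f_n)$ is a $p$-projection of $(g_m)$ if there is a polynomially bounded $t\colon\mathbb N\to\mathbb N$ such that $f_n$ is a projection of $g_{t(n)}$ for all $n$. A sequence is $\mathrm{VNP}$-complete if it belongs to $\mathrm{VNP}$ and every sequence in $\mathrm{VNP}$ is a $p$-projection of it. Finally, $\mathrm{PER}=(\mathrm{PER}_n)$, where $\mathrm{PER}_n$ is the permanent of an $n\times n$ matrix of independent variables over $\mathbb F$. Theorem. 1. If $\operatorname{char}\mathbb F\neq 2$, then $\mathrm{PER}$ is $\mathrm{VNP}$-complete. 2. If $\operatorname{char}\mathbb F\neq 2$ and $g\in\mathbb F[x_1,\dots,x_n,y_1,\dots,y_m]$ is computed by a formula of size less than $s$, then $\sum_{e\in\{0,1\}^m} g(x,e)$ is a projection of $\mathrm{PER}_{6s}$. 3. Over every field $\mathbb F$, the class $\mathrm{VNP}$ does not change if, in its definition, $(g_n)\in\mathrm{VP}$ is replaced by the stronger requirement $(g_n)\in\mathrm{VF}$. -/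

import Mathlib

/-- The label of a node `v` of an arithmetic circuit over the field `F` and the set `X` of variables,
together with the two nodes from which the incoming edges of `v` start (if `v` has indegree two). -/
inductive Gate (F X V : Type*) where
  | const (a : F) : Gate F X V
  | var (x : X) : Gate F X V
  | add (l r : V) : Gate F X V
  | mul (l r : V) : Gate F X V

namespace Gate

/-- The starting points of the edges entering a gate; the two edges may start at the same node. -/
def children {F X V : Type*} : Gate F X V → List V
  | const _ => []
  | var _ => []
  | add l r => [l, r]
  | mul l r => [l, r]

/-- Operation gates are the addition and the multiplication gates. -/
def IsOperation {F X V : Type*} : Gate F X V → Prop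
  | const _ => False
  | var _ => False
  | add _ _ => True
  | mul _ _ => True

end Gate

/-- An arithmetic circuit over `F` and the set `X` of variables: a finite directed acyclic graph in
which every node has indegree zero and is labelled by a constant or by a variable, or has indegree
two and is labelled by `+` or `×`. -/
structure Circuit (F X : Type*) where
  V : Type
  [fintypeV : Fintype V]
  gate : V → Gate F X V
  acyclic : ∀ v, ¬ Relation.TransGen (fun u w => u ∈ (gate w).children) v v

namespace Circuit

attribute [instance] Circuit.fintypeV

section Combinatorics

variable {F X : Type*} (Φ : Circuit F X)

/-- There is an edge from `u` to `w`, that is, `u` is a child of `w`. -/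
def Edge (u w : Φ.V) : Prop := u ∈ (Φ.gate w).children

theorem wellFounded_edge : WellFounded Φ.Edge := by
  have : Std.Irrefl (Relation.TransGen Φ.Edge) := ⟨Φ.acyclic⟩
  exact Subrelation.wf (fun h => Relation.TransGen.single h)
    (Finite.wellFounded_of_trans_of_irrefl (Relation.TransGen Φ.Edge))

/-- The size: the number of operation gates. -/
noncomputable def size : ℕ := Nat.card {v : Φ.V // (Φ.gate v).IsOperation}

/-- `u` belongs to the subcircuit with root `v`: there is a directed path (possibly of length zero)
from `u` to `v`. -/
def InSubcircuit (u v : Φ.V) : Prop := Relation.ReflTransGen Φ.Edge u v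

/-- For each multiplication gate, the subcircuits at its two children are disjoint. -/
def MultiplicativelyDisjoint : Prop :=
  ∀ v l r, Φ.gate v = Gate.mul l r → ∀ u, ¬ (Φ.InSubcircuit u l ∧ Φ.InSubcircuit u r)

open Classical in
/-- The outdegree of a node, parallel edges being counted with multiplicity. -/
noncomputable def outdegree (u : Φ.V) : ℕ := ∑ v, (Φ.gate v).children.count u

/-- The circuit is a formula: every gate has outdegree at most one. -/
def IsFormula : Prop := ∀ u, Φ.outdegree u ≤ 1

end Combinatorics

section Value

variable {F : Type*} [Field F] {X : Type*} (Φ : Circuit F X)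

/-- The polynomial at a gate, from the polynomials at its children. -/
noncomputable def step (v : Φ.V) (p : ∀ u, Φ.Edge u v → MvPolynomial X F) : MvPolynomial X F :=
  match h : Φ.gate v with
  | Gate.const a => MvPolynomial.C a
  | Gate.var x => MvPolynomial.X x
  | Gate.add l r => p l (by simp [Edge, h, Gate.children]) + p r (by simp [Edge, h, Gate.children])
  | Gate.mul l r => p l (by simp [Edge, h, Gate.children]) * p r (by simp [Edge, h, Gate.children])

/-- The polynomial computed by the circuit at the gate `v`. -/
noncomputable def value : Φ.V → MvPolynomial X F := Φ.wellFounded_edge.fix Φ.step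

theorem value_eq (v : Φ.V) : Φ.value v =
    match Φ.gate v with
    | Gate.const a => MvPolynomial.C a
    | Gate.var x => MvPolynomial.X x
    | Gate.add l r => Φ.value l + Φ.value r
    | Gate.mul l r => Φ.value l * Φ.value r := by
  have h : Φ.value v = Φ.step v (fun u _ => Φ.value u) := Φ.wellFounded_edge.fix_eq Φ.step v
  rw [h, step]
  split <;> rename_i h' <;> simp [h']

/-- The circuit computes `f`: it does so at some gate. -/
def Computes (f : MvPolynomial X F) : Prop := ∃ v, Φ.value v = f

end Value

end Circuit

/-- A sequence `(fₙ)` of multivariate polynomials over `F`, where `fₙ` is a polynomial in a finite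
set of variables depending on `n`; no relation between the sets of variables is required. -/
structure PolyFamily (F : Type*) [Field F] where
  Var : ℕ → Type
  [finiteVar : ∀ n, Finite (Var n)]
  poly : ∀ n, MvPolynomial (Var n) F

/-- `t : ℕ → ℕ` is bounded by a polynomial. -/
def PolynomiallyBounded (t : ℕ → ℕ) : Prop := ∃ p : Polynomial ℕ, ∀ n, t n ≤ p.eval n

section Projections

variable {F : Type*} [Field F]

/-- `f` is a projection of `g`: it arises from `g` by substituting for every variable of `g` a
variable of `f` or a constant. -/
def IsProjection {X Y : Type*} (f : MvPolynomial X F) (g : MvPolynomial Y F) : Prop :=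
  ∃ a : Y → F ⊕ X, f = MvPolynomial.aeval (fun y => Sum.elim MvPolynomial.C MvPolynomial.X (a y)) g

/-- The sequence `f` is a p-projection of the sequence `g`. -/
def IsPProjection (f g : PolyFamily F) : Prop :=
  ∃ t : ℕ → ℕ, PolynomiallyBounded t ∧ ∀ n, IsProjection (f.poly n) (g.poly (t n))

/-- `g` is complete for the class `𝒞` under p-projections. -/
def IsCompleteFor (𝒞 : Set (PolyFamily F)) (g : PolyFamily F) : Prop :=
  g ∈ 𝒞 ∧ ∀ f ∈ 𝒞, IsPProjection f g

/-- The polynomial `∑_{e ∈ {0,1}ᵐ} g(x, e)` in the variables `x`. -/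
noncomputable def boolSum {X : Type*} {m : ℕ} (g : MvPolynomial (X ⊕ Fin m) F) :
    MvPolynomial X F :=
  ∑ e : Fin m → Fin 2, MvPolynomial.aeval
    (Sum.elim MvPolynomial.X (fun i => if e i = 1 then (1 : MvPolynomial X F) else 0)) g

end Projections

section Classes

variable (F : Type*) [Field F]

/-- The class `VP`: polynomial size multiplicatively disjoint circuits. -/
def VP : Set (PolyFamily F) :=
  {f | ∃ Φ : ∀ n, Circuit F (f.Var n),
    (∀ n, (Φ n).MultiplicativelyDisjoint ∧ (Φ n).Computes (f.poly n)) ∧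
      PolynomiallyBounded (fun n => (Φ n).size)}

/-- The class `VF`: polynomial size formulas. -/
def VF : Set (PolyFamily F) :=
  {f | ∃ Φ : ∀ n, Circuit F (f.Var n),
    (∀ n, (Φ n).IsFormula ∧ (Φ n).Computes (f.poly n)) ∧
      PolynomiallyBounded (fun n => (Φ n).size)}

variable {F} in
/-- The sequences `(fₙ)` for which there is a sequence `(gₙ)` in the class `𝒞`, where `gₙ` has the
variables of `fₙ` and `k n` further ones, such that `fₙ` is obtained from `gₙ` by summing over all
substitutions of values in `{0,1}` for the further variables. -/
def boolSumsOf (𝒞 : Set (PolyFamily F)) : Set (PolyFamily F) :=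
  {f | ∃ (k : ℕ → ℕ) (g : ∀ n, MvPolynomial (f.Var n ⊕ Fin (k n)) F),
    haveI := f.finiteVar
    PolyFamily.mk (fun n => f.Var n ⊕ Fin (k n)) g ∈ 𝒞 ∧ ∀ n, f.poly n = boolSum (g n)}

/-- The class `VNP` of p-definable sequences. -/
def VNP : Set (PolyFamily F) := boolSumsOf (VP F)

/-- The sequence `PER` whose `n`-th member is the permanent of an `n` by `n` matrix of independent
variables. -/
noncomputable def PER : PolyFamily F where
  Var n := Fin n × Fin n
  poly n := (Matrix.mvPolynomialX (Fin n) (Fin n) F).permanent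

end Classes

/-! Hardness is proved by working with permanents of matrices of constants and variables. An
expression, seen as a 1×1 matrix, is expanded one operation at a time: a new index with loop weight
1 on a path from `u` to `v` adds a product to the entry `(u, v)` (`permanent_bordered_single`,
`exists_label_of_tree`).

A variable `y` is then summed over {0,1} inside the permanent (`exists_label_sum_chain`). An extra
isolated index with a loop serves as a switch, which is on when its row is replaced by a unit
vector. Every occurrence of `y` is replaced by 0 and tied to the switch by the gadget `coupled`:
with the switch off the entry stays 0, with the switch on it becomes 1, and a new row becomes the
switch for the next occurrence. Finally 1 is added to the entry of the last switch, and linearity in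
that row yields the sum of the off and on values. The gadget needs the constant 1/2; this is where
characteristic 2 is excluded.

To replace VP by VF, the value of a multiplicatively disjoint circuit is written as a sum over its
parse trees: at each addition gate one child is chosen, at each multiplication gate both are kept.
Disjointness ensures that no gate is used twice, so a parse tree is coded by one bit per edge, and a
formula of quadratic size checks the code and multiplies the input labels
(`listBoolSum_parseValue`). Formulas are exchanged with expression trees by `IsFormula.exists_tree`
and `ArithTree.exists_formula`.

Membership of the permanent in VNP follows from Ryser's formula, which is itself a Boolean sum of a
small expression. -/

namespace Matrix

/-! ### Permanents of bordered matrices and the coupling gadget. -/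

section Bordered

variable {ι α β : Type*}

/-- The matrix `B` with one further column `c`, one further row `r` and the corner entry `a`. -/
def bordered (B : Matrix ι ι α) (c r : ι → α) (a : α) : Matrix (Option ι) (Option ι) α
  | some i, some j => B i j
  | some i, none => c i
  | none, some j => r j
  | none, none => a

variable (B : Matrix ι ι α) (c r : ι → α) (a : α)

@[simp] theorem bordered_some_some (i j : ι) : bordered B c r a (some i) (some j) = B i j := rfl
@[simp] theorem bordered_some_none (i : ι) : bordered B c r a (some i) none = c i := rfl
@[simp] theorem bordered_none_some (j : ι) : bordered B c r a none (some j) = r j := rfl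
@[simp] theorem bordered_none_none : bordered B c r a none none = a := rfl

theorem map_bordered (f : α → β) :
    (bordered B c r a).map f = bordered (B.map f) (f ∘ c) (f ∘ r) (f a) := by
  ext (_ | i) (_ | j) <;> rfl

variable [DecidableEq ι]

theorem updateRow_bordered_none (x : Option ι → α) :
    (bordered B c r a).updateRow none x = bordered B c (fun j => x (some j)) (x none) := by
  ext (_ | i) (_ | j) <;> simp [updateRow_apply]

theorem updateRow_bordered_some (k : ι) (x : Option ι → α) :
    (bordered B c r a).updateRow (some k) x =
      bordered (B.updateRow k fun j => x (some j)) (Function.update c k (x none)) r a := by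
  ext (_ | i) (_ | j) <;> simp [updateRow_apply, Function.update_apply]

end Bordered

section Permanent

variable {ι κ R : Type*} [DecidableEq ι] [Fintype ι] [DecidableEq κ] [Fintype κ] [CommRing R]

theorem permanent_reindex (e : ι ≃ κ) (M : Matrix ι ι R) :
    (M.reindex e e).permanent = M.permanent := by
  unfold permanent
  refine (Fintype.sum_equiv (Equiv.permCongr e) _ _ fun σ => ?_).symm
  exact Fintype.prod_equiv e _ _ fun i => by simp

/-- The permutations are sorted by the row in which they meet the new column. If it is row `k` of
`B`, the new row `r` takes its place. -/
theorem permanent_bordered (B : Matrix ι ι R) (c r : ι → R) (a : R) :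
    (bordered B c r a).permanent =
      a * B.permanent + ∑ k, c k * (B.updateRow k r).permanent := by
  simp only [permanent]
  rw [← (Equiv.Perm.decomposeOption (α := ι)).symm.sum_comp, Fintype.sum_prod_type,
    Fintype.sum_option]
  congr 1
  · rw [Finset.mul_sum]
    refine Finset.sum_congr rfl fun σ _ => ?_
    simp [Fintype.prod_option, Equiv.Perm.decomposeOption]
  · refine Finset.sum_congr rfl fun k _ => ?_
    rw [Finset.mul_sum]
    refine Finset.sum_congr rfl fun σ _ => ?_
    simp only [Fintype.prod_option, Equiv.Perm.decomposeOption_symm_apply, Equiv.Perm.coe_mul,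
      Function.comp, Equiv.optionCongr_apply, Option.map_none, Option.map_some,
      Equiv.swap_apply_left, bordered_some_none]
    congr 1
    refine Finset.prod_congr rfl fun i _ => ?_
    by_cases h : σ i = k
    · subst h; simp
    · rw [Equiv.swap_apply_of_ne_of_ne (by simp) (by simpa using h), bordered_some_some,
        updateRow_ne h]

theorem permanent_updateRow_add (M : Matrix ι ι R) (k : ι) (x y : ι → R) :
    (M.updateRow k (x + y)).permanent =
      (M.updateRow k x).permanent + (M.updateRow k y).permanent := by
  simp only [permanent, ← Finset.sum_add_distrib]
  refine Finset.sum_congr rfl fun σ _ => ?_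
  have key : ∀ z : ι → R, ∏ i, M.updateRow k z (σ i) i =
      z (σ.symm k) * ∏ i ∈ Finset.univ.erase (σ.symm k), M (σ i) i := by
    intro z
    rw [← Finset.mul_prod_erase _ _ (Finset.mem_univ (σ.symm k))]
    congr 1
    · simp
    · refine Finset.prod_congr rfl fun i hi => ?_
      rw [updateRow_ne]
      rintro rfl
      simp at hi
  simp only [key, Pi.add_apply, add_mul]

theorem permanent_updateRow_smul' (M : Matrix ι ι R) (k : ι) (a : R) (x : ι → R) :
    (M.updateRow k (fun j => a * x j)).permanent = a * (M.updateRow k x).permanent :=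
  permanent_updateRow_smul M k a x

theorem permanent_updateRow_zero (M : Matrix ι ι R) (k : ι) :
    (M.updateRow k (fun _ => 0)).permanent = 0 := by
  simpa using permanent_updateRow_smul' M k 0 0

theorem updateRow_add_single (M : Matrix ι ι R) (u v : ι) (x : R) :
    (M.updateRow u (M u + Pi.single v x)).permanent =
      M.permanent + x * (M.updateRow u (Pi.single v 1)).permanent := by
  rw [permanent_updateRow_add, updateRow_eq_self, ← permanent_updateRow_smul]
  congr 3
  ext j
  by_cases h : j = v <;> simp [h]

/-- One new index on a path from `u` to `v` adds the product of the two weights to the entry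
`(u, v)`. -/
theorem permanent_bordered_single (B : Matrix ι ι R) (u v : ι) (x y : R) :
    (bordered B (Pi.single u x) (Pi.single v y) 1).permanent =
      (B.updateRow u (B u + Pi.single v (x * y))).permanent := by
  have hy : Pi.single v y = fun j => y * (Pi.single v 1 : ι → R) j := by
    ext j
    by_cases h : j = v <;> simp [h]
  rw [permanent_bordered, updateRow_add_single, Finset.sum_eq_single u, one_mul, mul_assoc, hy,
    permanent_updateRow_smul', Pi.single_eq_same]
  · intro k _ hk
    simp [hk]
  · simp

/-- The coupling of the entry `(u, v)` with the row `a`: three new indices, the second of which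
takes over the role of `a`. -/
def coupled {α : Type*} (f : R → α) (h : R) (B : Matrix ι ι α) (u v a : ι) :
    Matrix (Option (Option (Option ι))) (Option (Option (Option ι))) α :=
  bordered
    (bordered
      (bordered B (Function.update (fun _ => f 0) u (f 1)) (Function.update (fun _ => f 0) v (f 1))
        (f 0))
      (fun i => i.elim (f h) (Function.update (fun _ => f 0) a (f 1)))
      (fun i => i.elim (f (-1)) (fun _ => f 0)) (f h))
    (fun i => i.elim (f 1) (fun i => i.elim (f 1) (fun _ => f 0)))
    (fun i => i.elim (f (-h)) (fun i => i.elim (f 1) (fun _ => f 0)))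
    (f 1)

theorem sum_ite_ite {u a : ι} (hua : u ≠ a) (p q : ι → R) :
    (∑ x, if x = a then p x else if x = u then q x else 0) = p a + q u := by
  rw [Fintype.sum_eq_add a u hua.symm]
  · simp [hua]
  · rintro x ⟨h1, h2⟩
    simp [h1, h2]

theorem permanent_updateRow_updateRow_zero (M : Matrix ι ι R) {u a : ι} (hua : u ≠ a)
    (x : ι → R) : ((M.updateRow a fun _ => 0).updateRow u x).permanent = 0 := by
  rw [updateRow_comm _ hua.symm, permanent_updateRow_zero]

/-- On the three new indices, in the order of their introduction, the matrix has rows `(0, h, 1)`,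
`(-1, h, 1)`, `(1, -h, 1)`, with permanent `2h = 1`. The detour from `u` to `v` through the first
index leaves the factor `h - h`, and the detour from `a` through the second and on to `v` leaves `-1
+ 1`, so both cancel. -/
theorem permanent_coupled {h : R} (hh : 2 * h = 1) (B : Matrix ι ι R) {u v a : ι} (hua : u ≠ a) :
    (coupled id h B u v a).permanent = B.permanent := by
  simp only [coupled, permanent_bordered, updateRow_bordered_none, updateRow_bordered_some,
    Fintype.sum_option, Option.elim, id]
  simp only [Function.update_self, Function.update_apply, ite_mul, zero_mul, one_mul,
    Finset.sum_ite_eq', Finset.mem_univ, if_true, reduceCtorEq, if_false, Option.some.injEq,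
    permanent_updateRow_zero, Finset.sum_const_zero, add_zero, zero_add, mul_zero,
    sum_ite_ite hua, permanent_updateRow_updateRow_zero _ hua]
  linear_combination B.permanent * hh

/-- Now the second new row leads only to `b`. If row `a` does not enter the second index, the
remaining factor is `h - h = 0`. So `a` is routed to `b` through it, while `u` either keeps its row
or makes the detour to `v` with weight 1. No condition on `h` is needed. -/
theorem permanent_coupled_updateRow {h : R} (B : Matrix ι ι R) {u v a : ι} (hua : u ≠ a) (b : ι) :
    ((coupled id h B u v a).updateRow (some none) (Pi.single (some (some (some b))) 1)).permanent =
      ((B.updateRow u (B u + Pi.single v 1)).updateRow a (Pi.single b 1)).permanent := by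
  have hb : (fun j => if j = b then 1 else 0 : ι → R) = Pi.single b 1 := by
    ext j
    simp [Pi.single_apply]
  have hv : (Function.update (fun _ => 0) v 1 : ι → R) = Pi.single v 1 := by
    ext j
    simp [Pi.single_apply, Function.update_apply]
  simp only [coupled, permanent_bordered, updateRow_bordered_none, updateRow_bordered_some,
    Fintype.sum_option, Option.elim, id]
  simp only [hv, Pi.single_apply (some (some (some b))), Function.update_self,
    Function.update_apply, ite_mul, zero_mul, one_mul,
    Finset.sum_ite_eq', Finset.mem_univ, if_true, reduceCtorEq, if_false, Option.some.injEq,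
    permanent_updateRow_zero, Finset.sum_const_zero, add_zero, zero_add, mul_zero,
    sum_ite_ite hua, permanent_updateRow_updateRow_zero _ hua]
  have hu : (B.updateRow a (Pi.single b 1)).updateRow u (B u) = B.updateRow a (Pi.single b 1) := by
    rw [updateRow_comm _ hua.symm, updateRow_eq_self]
  rw [hb, updateRow_comm _ hua, permanent_updateRow_add, hu]
  ring

end Permanent

end Matrix

/-! ### Arithmetic expressions and their expansion into matrices. -/

/-- Arithmetic expressions with constants from `F` and variables from `Z`. -/
inductive ArithTree (F Z : Type*) where
  | const (a : F) : ArithTree F Z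
  | var (z : Z) : ArithTree F Z
  | add (l r : ArithTree F Z) : ArithTree F Z
  | mul (l r : ArithTree F Z) : ArithTree F Z

namespace ArithTree

variable {F Z : Type*}

/-- The number of operations. -/
def ops : ArithTree F Z → ℕ
  | const _ => 0
  | var _ => 0
  | add l r => l.ops + r.ops + 1
  | mul l r => l.ops + r.ops + 1

open Classical in
/-- The number of occurrences of a variable. -/
noncomputable def occurrences (w : Z) : ArithTree F Z → ℕ
  | const _ => 0
  | var z => if z = w then 1 else 0
  | add l r => l.occurrences w + r.occurrences w
  | mul l r => l.occurrences w + r.occurrences w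

/-- A binary tree has one more leaf than it has operations. -/
theorem sum_occurrences_le (s : Finset Z) (t : ArithTree F Z) :
    ∑ w ∈ s, t.occurrences w ≤ t.ops + 1 := by
  classical
  induction t with
  | const a => simp [occurrences]
  | var z =>
    simp only [occurrences, ops, Finset.sum_ite_eq]
    split <;> simp
  | add l r hl hr => simp only [occurrences, ops, Finset.sum_add_distrib]; omega
  | mul l r hl hr => simp only [occurrences, ops, Finset.sum_add_distrib]; omega

/-- The value under an assignment of elements of an algebra to the variables. -/
def eval [CommSemiring F] {R : Type*} [CommSemiring R] [Algebra F R] (ρ : Z → R) :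
    ArithTree F Z → R
  | const a => algebraMap F R a
  | var z => ρ z
  | add l r => l.eval ρ + r.eval ρ
  | mul l r => l.eval ρ * r.eval ρ

end ArithTree

namespace Matrix

section SetEntry

variable {ι α β : Type*} [DecidableEq ι]

/-- The matrix `M` with the entry at `(u, v)` replaced by `x`. -/
def setEntry (M : Matrix ι ι α) (u v : ι) (x : α) : Matrix ι ι α :=
  M.updateRow u (Function.update (M u) v x)

theorem setEntry_apply (M : Matrix ι ι α) (u v : ι) (x : α) (i j : ι) :
    M.setEntry u v x i j = if i = u ∧ j = v then x else M i j := by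
  by_cases hi : i = u
  · subst hi
    by_cases hj : j = v <;> simp [setEntry, hj]
  · simp [setEntry, hi]

theorem map_setEntry (M : Matrix ι ι α) (u v : ι) (x : α) (f : α → β) :
    (M.setEntry u v x).map f = (M.map f).setEntry u v (f x) := by
  ext i j
  simp only [map_apply, setEntry_apply, apply_ite f]

end SetEntry

section Weight

variable {ι κ α β : Type*} [Fintype ι] [Fintype κ]

/-- The sum of the weights of the entries of a matrix. -/
def weight (wt : α → ℕ) (M : Matrix ι ι α) : ℕ := ∑ i, ∑ j, wt (M i j)

theorem weight_reindex (wt : α → ℕ) (e : ι ≃ κ) (M : Matrix ι ι α) :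
    (M.reindex e e).weight wt = M.weight wt := by
  simp only [weight, reindex_apply, submatrix_apply]
  rw [e.symm.sum_comp (fun i => ∑ j, wt (M i (e.symm j)))]
  exact Finset.sum_congr rfl fun i _ => e.symm.sum_comp (fun j => wt (M i j))

theorem weight_bordered (wt : α → ℕ) (B : Matrix ι ι α) (c r : ι → α) (a : α) :
    (bordered B c r a).weight wt = B.weight wt + ∑ i, wt (c i) + ∑ j, wt (r j) + wt a := by
  simp only [weight, Fintype.sum_option, bordered_some_some, bordered_some_none,
    bordered_none_some, bordered_none_none, Finset.sum_add_distrib]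
  ring

theorem exists_pos_of_weight_pos {wt : α → ℕ} {M : Matrix ι ι α} (h : 0 < M.weight wt) :
    ∃ u v, 0 < wt (M u v) := by
  by_contra! hc
  simp only [Nat.le_zero] at hc
  simp [weight, hc] at h

theorem weight_eq_zero_iff {wt : α → ℕ} {M : Matrix ι ι α} :
    M.weight wt = 0 ↔ ∀ i j, wt (M i j) = 0 := by
  simp [weight, Finset.sum_eq_zero_iff]

variable [DecidableEq ι]

theorem sum_update_weight (wt : α → ℕ) (z : ι → α) (v : ι) (x : α) :
    (∑ j, wt (Function.update z v x j)) + wt (z v) = (∑ j, wt (z j)) + wt x := by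
  rw [← Finset.add_sum_erase _ _ (Finset.mem_univ v),
    ← Finset.add_sum_erase (a := v) (f := fun j => wt (z j)) _ (Finset.mem_univ v),
    Function.update_self,
    Finset.sum_congr rfl fun j hj => by rw [Function.update_of_ne (Finset.ne_of_mem_erase hj)]]
  ring

theorem sum_update_const_weight (wt : α → ℕ) {z : α} (hz : wt z = 0) (v : ι) (x : α) :
    (∑ j, wt (Function.update (fun _ => z) v x j)) = wt x := by
  simpa [hz] using sum_update_weight wt (fun _ => z) v x

theorem weight_setEntry (wt : α → ℕ) (M : Matrix ι ι α) (u v : ι) (x : α) :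
    (M.setEntry u v x).weight wt + wt (M u v) = M.weight wt + wt x := by
  have h := sum_update_weight wt (M u) v x
  have h' : (M.setEntry u v x).weight wt + ∑ j, wt (M u j) =
      M.weight wt + ∑ j, wt (Function.update (M u) v x j) :=
    sum_update_weight (fun row : ι → α => ∑ j, wt (row j)) M u (Function.update (M u) v x)
  omega

theorem weight_coupled {R : Type*} [CommRing R] (wt : α → ℕ) {f : R → α} (hf : ∀ x, wt (f x) = 0)
    (h : R) (B : Matrix ι ι α) (u v a : ι) : (coupled f h B u v a).weight wt = B.weight wt := by
  simp [coupled, weight_bordered, hf, sum_update_const_weight, Fintype.sum_option]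

end Weight

theorem map_coupled {ι α β R : Type*} [DecidableEq ι] [CommRing R] (f : R → α) (h : R)
    (B : Matrix ι ι α) (u v a : ι) (g : α → β) :
    (coupled f h B u v a).map g = coupled (g ∘ f) h (B.map g) u v a := by
  simp only [coupled, map_bordered]
  congr 1
  · congr 1
    · congr 1
      · exact Function.comp_update ..
      · exact Function.comp_update ..
    · ext (_ | i)
      · rfl
      · simp [Function.update_apply, apply_ite g]
    · ext (_ | i) <;> rfl
  · ext (_ | _ | i) <;> rfl
  · ext (_ | _ | i) <;> rfl

theorem coupled_algebraMap {ι F R : Type*} [DecidableEq ι] [CommRing F] [CommRing R] [Algebra F R]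
    (h : F) (B : Matrix ι ι R) (u v a : ι) :
    coupled (algebraMap F R) h B u v a = coupled id (algebraMap F R h) B u v a := by
  simp [coupled]

section Label

variable {F W R : Type*} [CommRing F] [CommRing R] [Algebra F R]
variable {ι κ : Type} [Fintype ι] [DecidableEq ι] [Fintype κ] [DecidableEq κ]

/-- The permanent of a matrix of constants and variables, for given values of the variables. -/
noncomputable def labelPermanent (ρ : W → R) (A : Matrix ι ι (F ⊕ W)) : R :=
  (A.map (Sum.elim (algebraMap F R) ρ)).permanent

open Classical in
/-- The weight function that counts the occurrences of a variable. -/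
noncomputable def labelCount (w : W) (x : F ⊕ W) : ℕ := if x = Sum.inr w then 1 else 0

@[simp] theorem labelCount_inl {F W : Type*} (w : W) (a : F) : labelCount w (Sum.inl a) = 0 := by
  simp [labelCount]

/-- Every matrix of expressions can be enlarged to a matrix of constants and variables that has the
same permanent, at the cost of one new index for each operation. -/
theorem exists_label_of_tree (k : ℕ) : ∀ (ι : Type) [Fintype ι] [DecidableEq ι]
    (M : Matrix ι ι (ArithTree F W)), M.weight ArithTree.ops = k →
    ∀ N, N = Fintype.card ι + k → ∃ A : Matrix (Fin N) (Fin N) (F ⊕ W),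
      (∀ w, A.weight (labelCount w) ≤ M.weight (ArithTree.occurrences w)) ∧
      ∀ ρ : W → R, A.labelPermanent ρ = (M.map (ArithTree.eval ρ)).permanent := by
  induction k with
  | zero =>
    intro ι _ _ M hM N hN
    rw [weight_eq_zero_iff] at hM
    have hl : ∀ t : ArithTree F W, t.ops = 0 → ∃ x : F ⊕ W,
        (∀ w, labelCount w x ≤ t.occurrences w) ∧
          ∀ ρ : W → R, Sum.elim (algebraMap F R) ρ x = t.eval ρ := by
      intro t ht
      cases t with
      | const a => exact ⟨Sum.inl a, by simp, fun ρ => rfl⟩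
      | var z => exact ⟨Sum.inr z, fun w => by
        by_cases h : z = w <;> simp [labelCount, ArithTree.occurrences, h], fun ρ => rfl⟩
      | add l r => simp [ArithTree.ops] at ht
      | mul l r => simp [ArithTree.ops] at ht
    choose A hA hA' using fun i j => hl (M i j) (hM i j)
    let e : ι ≃ Fin N := Fintype.equivFinOfCardEq (by simp [hN])
    refine ⟨Matrix.reindex e e (Matrix.of A), fun w => ?_, fun ρ => ?_⟩
    · rw [weight_reindex]
      exact Finset.sum_le_sum fun i _ => Finset.sum_le_sum fun j _ => hA i j w
    · rw [labelPermanent, ← permanent_reindex e (M.map _)]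
      congr 1
      ext i j
      exact hA' _ _ ρ
  | succ k ih =>
    intro ι _ _ M hM N hN
    obtain ⟨u, v, huv⟩ := exists_pos_of_weight_pos (M := M) (wt := ArithTree.ops) (by omega)
    -- Both operations fit the shape `x0 + x1 * x2`: a sum as `r + l * 1`, a product as `0 + l * r`.
    -- The term `x0` stays at `(u, v)`, and `x1`, `x2` label the path through the new index.
    have hstep : ∀ x0 x1 x2 : ArithTree F W, x0.ops + x1.ops + x2.ops + 1 = (M u v).ops →
        (∀ w, x0.occurrences w + x1.occurrences w + x2.occurrences w = (M u v).occurrences w) →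
        (∀ ρ : W → R, x0.eval ρ + x1.eval ρ * x2.eval ρ = (M u v).eval ρ) →
        ∃ A : Matrix (Fin N) (Fin N) (F ⊕ W),
          (∀ w, A.weight (labelCount w) ≤ M.weight (ArithTree.occurrences w)) ∧
          ∀ ρ : W → R, A.labelPermanent ρ = (M.map (ArithTree.eval ρ)).permanent := by
      intro x0 x1 x2 h1 h2 h3
      have hw : ∀ wt : ArithTree F W → ℕ, wt (.const 0) = 0 → wt (.const 1) = 0 →
          (bordered (M.setEntry u v x0) (Function.update (fun _ => .const 0) u x1)
            (Function.update (fun _ => .const 0) v x2) (.const 1)).weight wt + wt (M u v) =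
          M.weight wt + wt x0 + wt x1 + wt x2 := by
        intro wt h0 h1
        rw [weight_bordered, sum_update_const_weight _ h0, sum_update_const_weight _ h0, h1]
        have := weight_setEntry wt M u v x0
        omega
      obtain ⟨A, hA, hA'⟩ := ih (Option ι)
        (bordered (M.setEntry u v x0) (Function.update (fun _ => .const 0) u x1)
            (Function.update (fun _ => .const 0) v x2) (.const 1))
        (by have := hw ArithTree.ops rfl rfl; omega) N (by simp; omega)
      refine ⟨A, fun w => (hA w).trans ?_, fun ρ => (hA' ρ).trans ?_⟩
      · have := hw (ArithTree.occurrences w) rfl rfl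
        have := h2 w
        omega
      · rw [map_bordered, Function.comp_update, Function.comp_update, map_setEntry]
        have h0 : ArithTree.eval ρ ∘ (fun _ : ι => (.const 0 : ArithTree F W)) =
            (0 : ι → R) := by
          ext i
          simp [ArithTree.eval]
        have h1 : ArithTree.eval ρ (.const 1 : ArithTree F W) = (1 : R) := by
          simp [ArithTree.eval]
        rw [h0, h1]
        refine (permanent_bordered_single _ u v _ _).trans ?_
        congr 1
        ext i j
        by_cases hi : i = u
        · subst hi
          by_cases hj : j = v
          · subst hj
            simp [setEntry_apply, h3]
          · simp [setEntry_apply, hj]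
        · simp [setEntry_apply, hi]
    cases ht : M u v with
    | const a => simp [ht, ArithTree.ops] at huv
    | var z => simp [ht, ArithTree.ops] at huv
    | add l r =>
      refine hstep r l (.const 1) ?_ ?_ ?_
      · simp [ht, ArithTree.ops]; omega
      · intro w; simp [ht, ArithTree.occurrences]; omega
      · intro ρ; simp [ht, ArithTree.eval]; ring
    | mul l r =>
      refine hstep (.const 0) l r ?_ ?_ ?_
      · simp [ht, ArithTree.ops]
      · intro w; simp [ht, ArithTree.occurrences]
      · intro ρ; simp [ht, ArithTree.eval]

end Label

end Matrix

/-! ### Boolean sums taken one variable at a time. -/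

section BoolSum

variable {W R : Type*} [DecidableEq W] [CommRing R]

/-- The sum of the values of `h` over all assignments of zeros and ones to the variables in a list,
the other variables having their values under `ρ`. -/
def listBoolSum (h : (W → R) → R) : List W → (W → R) → R
  | [], ρ => h ρ
  | y :: ys, ρ =>
    listBoolSum h ys (Function.update ρ y 0) + listBoolSum h ys (Function.update ρ y 1)

theorem listBoolSum_congr {h h' : (W → R) → R} : ∀ (ys : List W) (ρ : W → R),
    (∀ ρ', (∀ w, w ∉ ys → ρ' w = ρ w) → h ρ' = h' ρ') →
      listBoolSum h ys ρ = listBoolSum h' ys ρ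
  | [], ρ, H => H ρ fun _ _ => rfl
  | y :: ys, ρ, H => by
    have key : ∀ x : R, ∀ ρ', (∀ w, w ∉ ys → ρ' w = Function.update ρ y x w) → h ρ' = h' ρ' := by
      intro x ρ' h'
      refine H ρ' fun w hw => ?_
      rw [List.mem_cons, not_or] at hw
      rw [h' w hw.2, Function.update_of_ne hw.1]
    rw [listBoolSum, listBoolSum, listBoolSum_congr ys _ (key 0), listBoolSum_congr ys _ (key 1)]

theorem listBoolSum_mul_left (x : R) (h : (W → R) → R) : ∀ (ys : List W) (ρ : W → R),
    listBoolSum (fun ρ => x * h ρ) ys ρ = x * listBoolSum h ys ρ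
  | [], ρ => rfl
  | y :: ys, ρ => by
    rw [listBoolSum, listBoolSum, listBoolSum_mul_left x h ys, listBoolSum_mul_left x h ys, mul_add]

theorem listBoolSum_map_inr {X Y : Type*} [DecidableEq X] [DecidableEq Y]
    (h : (X ⊕ Y → R) → R) : ∀ (ys : List Y) (_ : ys.Nodup) (ρ : X ⊕ Y → R),
    listBoolSum h (ys.map Sum.inr) ρ = ∑ A ∈ ys.toFinset.powerset,
      h (Sum.elim (fun x => ρ (Sum.inl x))
        fun y => if y ∈ ys then (if y ∈ A then 1 else 0) else ρ (Sum.inr y))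
  | [], _, ρ => by
    simp only [List.map_nil, listBoolSum, List.toFinset_nil, Finset.powerset_empty,
      Finset.sum_singleton, List.not_mem_nil, if_false]
    congr 1
    ext (x | y) <;> rfl
  | y :: ys, hn, ρ => by
    rw [List.nodup_cons] at hn
    have hy : y ∉ ys.toFinset := by simpa using hn.1
    rw [List.map_cons, listBoolSum, listBoolSum_map_inr h ys hn.2, listBoolSum_map_inr h ys hn.2,
      List.toFinset_cons, Finset.sum_powerset_insert hy]
    congr 1
    all_goals
      refine Finset.sum_congr rfl fun A hA => ?_
      congr 1
      ext (x | z)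
      · simp
      · have hyA : y ∉ A := fun hc => hy (Finset.mem_powerset.1 hA hc)
        by_cases hz : z = y
        · subst hz
          simp [hn.1, hyA]
        · simp [hz, Function.update_apply]

theorem listBoolSum_eq_sum {X Y : Type*} [DecidableEq X] [DecidableEq Y] [Fintype Y]
    (h : (X ⊕ Y → R) → R) {ys : List Y} (hn : ys.Nodup) (hy : ∀ y, y ∈ ys) (ρ : X ⊕ Y → R) :
    listBoolSum h (ys.map Sum.inr) ρ =
      ∑ e : Y → Fin 2, h (Sum.elim (fun x => ρ (Sum.inl x)) fun y => if e y = 1 then 1 else 0) := by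
  rw [listBoolSum_map_inr h ys hn]
  refine Finset.sum_bij' (fun A _ y => if y ∈ A then 1 else 0)
    (fun e _ => Finset.univ.filter fun y => e y = 1) ?_ ?_ ?_ ?_ ?_
  · simp
  · intro e _
    simp only [Finset.mem_powerset]
    intro y _
    simpa using hy y
  · intro A _
    ext y
    simp
  · intro e _
    ext y
    have : e y = 0 ∨ e y = 1 := by omega
    rcases this with h | h <;> simp [h]
  · intro A _
    congr 2
    ext y
    simp [hy]

end BoolSum

theorem ArithTree.eval_congr_hom {F Z R S : Type*} [CommSemiring F] [CommSemiring R]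
    [CommSemiring S] [Algebra F R] [Algebra F S] (φ : R →ₐ[F] S) (ρ : Z → R) (t : ArithTree F Z) :
    φ (t.eval ρ) = t.eval (fun z => φ (ρ z)) := by
  induction t with
  | const a => simp [eval]
  | var z => rfl
  | add l r hl hr => simp [eval, hl, hr]
  | mul l r hl hr => simp [eval, hl, hr]

theorem boolSum_eval {F X : Type*} [Field F] {m : ℕ} (t : ArithTree F (X ⊕ Fin m)) :
    boolSum (t.eval (MvPolynomial.X : _ → MvPolynomial (X ⊕ Fin m) F)) =
      ∑ e : Fin m → Fin 2, t.eval
        (Sum.elim MvPolynomial.X (fun i => if e i = 1 then (1 : MvPolynomial X F) else 0)) := by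
  simp only [boolSum, ArithTree.eval_congr_hom, MvPolynomial.aeval_X]

/-! ### Elimination of summation variables from a permanent. -/

namespace Matrix

section Padding

variable {F W R : Type*} [CommRing F] [CommRing R] [Algebra F R]

theorem labelPermanent_reindex {ι κ : Type} [Fintype ι] [DecidableEq ι] [Fintype κ] [DecidableEq κ]
    (e : ι ≃ κ) (A : Matrix ι ι (F ⊕ W)) (ρ : W → R) :
    (Matrix.reindex e e A).labelPermanent ρ = A.labelPermanent ρ :=
  permanent_reindex e (A.map _)

theorem exists_label_of_le {N : ℕ} (A : Matrix (Fin N) (Fin N) (F ⊕ W)) {M : ℕ} (hM : N ≤ M) :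
    ∃ A' : Matrix (Fin M) (Fin M) (F ⊕ W),
      (∀ w, A'.weight (labelCount w) = A.weight (labelCount w)) ∧
      ∀ ρ : W → R, A'.labelPermanent ρ = A.labelPermanent ρ := by
  induction M, hM using Nat.le_induction with
  | base => exact ⟨A, fun _ => rfl, fun _ => rfl⟩
  | succ M _ ih =>
    obtain ⟨A', h1, h2⟩ := ih
    let e : Option (Fin M) ≃ Fin (M + 1) := Fintype.equivFinOfCardEq (by simp)
    refine ⟨Matrix.reindex e e
      (bordered A' (fun _ => Sum.inl 0) (fun _ => Sum.inl 0) (Sum.inl 1)), fun w => ?_, fun ρ => ?_⟩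
    · rw [weight_reindex]
      simp [weight_bordered, h1]
    · rw [labelPermanent_reindex, ← h2, labelPermanent, map_bordered, permanent_bordered]
      simp [labelPermanent]

end Padding

section Elimination

variable {F W R : Type*} [CommRing F] [CommRing R] [Algebra F R] [DecidableEq W]

theorem labelPermanent_update {ι : Type} [Fintype ι] [DecidableEq ι] {T : Matrix ι ι (F ⊕ W)}
    {y : W} (hT : T.weight (labelCount y) = 0) (ρ : W → R) (x : R) :
    T.map (Sum.elim (algebraMap F R) (Function.update ρ y x)) =
      T.map (Sum.elim (algebraMap F R) ρ) := by
  rw [weight_eq_zero_iff] at hT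
  ext i j
  have := hT i j
  rw [map_apply, map_apply]
  cases h : T i j with
  | inl a => rfl
  | inr w =>
    have hw : w ≠ y := by
      rintro rfl
      simp [h, labelCount] at this
    simp [hw]

/-- Row `a` is the switch: it is on when the row is replaced by the unit vector at `b`. The
induction removes the `k` occurrences of `y` one by one, at three indices each, and keeps the sum of
the off value at `y = 0` and the on value at `y = 1`. -/
theorem exists_label_sum_chain {h : F} (hh : 2 * h = 1) (y : W) (k : ℕ) :
    ∀ (ι : Type) [Fintype ι] [DecidableEq ι] (T : Matrix ι ι (F ⊕ W)) (a b : ι) (d : F),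
    T a b = Sum.inl d → (∀ j, T a j ≠ Sum.inr y) → (∀ i, T i b ≠ Sum.inr y) →
    T.weight (labelCount y) = k → ∀ N, N = Fintype.card ι + 3 * k →
    ∃ A : Matrix (Fin N) (Fin N) (F ⊕ W), A.weight (labelCount y) = 0 ∧
      (∀ w, A.weight (labelCount w) ≤ T.weight (labelCount w)) ∧
      ∀ ρ : W → R, A.labelPermanent ρ = T.labelPermanent (Function.update ρ y 0) +
        ((T.map (Sum.elim (algebraMap F R) (Function.update ρ y 1))).updateRow a
          (Pi.single b 1)).permanent := by
  induction k with
  | zero =>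
    intro ι _ _ T a b d hd _ _ hT N hN
    let e : ι ≃ Fin N := Fintype.equivFinOfCardEq (by simp [hN])
    have hw : ∀ w, (T.setEntry a b (Sum.inl (d + 1))).weight (labelCount w) =
        T.weight (labelCount w) := by
      intro w
      have := weight_setEntry (labelCount w) T a b (Sum.inl (d + 1))
      simpa [hd] using this
    -- Once `y` is gone, both terms belong to the same matrix, and linearity in row `a` merges them
    -- by raising the constant at `(a, b)` by 1.
    refine ⟨Matrix.reindex e e (T.setEntry a b (Sum.inl (d + 1))), ?_, fun w => ?_, fun ρ => ?_⟩
    · rw [weight_reindex, hw, hT]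
    · rw [weight_reindex, hw]
    · rw [labelPermanent_reindex, labelPermanent, labelPermanent, labelPermanent_update hT,
        labelPermanent_update hT, ← one_mul ((updateRow _ _ _).permanent), ← updateRow_add_single]
      congr 1
      ext i j
      simp only [setEntry_apply, map_apply, updateRow_apply, Pi.add_apply, Pi.single_apply]
      by_cases hi : i = a
      · subst hi
        by_cases hj : j = b
        · subst hj
          simp [hd]
        · simp [hj]
      · simp [hi]
  | succ k ih =>
    intro ι _ _ T a b d hd ha hb hT N hN
    obtain ⟨u, v, huv⟩ := exists_pos_of_weight_pos (M := T) (wt := labelCount y) (by omega)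
    replace huv : T u v = Sum.inr y := by
      by_contra hc
      simp [labelCount, hc] at huv
    have hua : u ≠ a := by
      rintro rfl
      exact ha v huv
    set T0 := T.setEntry u v (Sum.inl 0) with hT0
    have hw : ∀ w, (coupled Sum.inl h T0 u v a).weight (labelCount w) + labelCount w (T u v) =
        T.weight (labelCount w) := by
      intro w
      rw [weight_coupled _ (fun x => labelCount_inl w x)]
      simpa using weight_setEntry (labelCount w) T u v (Sum.inl 0)
    -- The second new index of the gadget is the next switch; its entry in the old column `b` is the
    -- constant 0.
    obtain ⟨A, hA, hA', hA''⟩ := ih _ (coupled Sum.inl h T0 u v a) (some none)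
      (some (some (some b))) 0 rfl
      (by rintro (_ | _ | _ | i) <;> simp [coupled])
      (by
        rintro (_ | _ | _ | i)
        · simp [coupled]
        · simp [coupled]
        · by_cases hbv : b = v <;> simp [coupled, hbv]
        · simp only [coupled, bordered_some_some, hT0, setEntry_apply]
          split
          · simp
          · exact hb i)
      (by
        have hy := hw y
        have h1 : labelCount y (T u v) = 1 := by simp [huv, labelCount]
        omega) N
      (by simp; omega)
    refine ⟨A, hA, fun w => (hA' w).trans (by have := hw w; omega), fun ρ => ?_⟩
    rw [hA'' ρ, labelPermanent, map_coupled, map_coupled]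
    have hf : ∀ ρ : W → R, Sum.elim (algebraMap F R) ρ ∘ Sum.inl = algebraMap F R := fun _ => rfl
    have hh' : 2 * algebraMap F R h = 1 := by
      rw [← map_ofNat (algebraMap F R) 2, ← map_mul, hh, map_one]
    rw [hf, hf, coupled_algebraMap, coupled_algebraMap, permanent_coupled hh' _ hua,
      permanent_coupled_updateRow _ hua]
    congr 2
    · ext i j
      rw [map_apply, map_apply, hT0, setEntry_apply]
      split
      · rename_i hij
        simp [hij, huv]
      · rfl
    · congr 1
      ext i j
      simp only [hT0, setEntry_apply, map_apply, updateRow_apply, Pi.add_apply, Pi.single_apply]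
      by_cases hi : i = u
      · subst hi
        by_cases hj : j = v
        · subst hj
          simp [huv]
        · simp [hj]
      · simp [hi]

/-- Summation over the values zero and one of a variable. -/
theorem exists_label_sum {h : F} (hh : 2 * h = 1) (y : W) {ι : Type} [Fintype ι] [DecidableEq ι]
    (T : Matrix ι ι (F ⊕ W)) : ∃ (N : ℕ) (A : Matrix (Fin N) (Fin N) (F ⊕ W)) (c : F),
      N ≤ Fintype.card ι + 4 * T.weight (labelCount y) ∧ A.weight (labelCount y) = 0 ∧
      (∀ w, A.weight (labelCount w) ≤ T.weight (labelCount w)) ∧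
      ∀ ρ : W → R, algebraMap F R c * A.labelPermanent ρ =
        T.labelPermanent (Function.update ρ y 0) + T.labelPermanent (Function.update ρ y 1) := by
  by_cases h0 : T.weight (labelCount y) = 0
  -- An absent variable only doubles the permanent; the factor `c = 2` records this without
  -- enlarging the matrix.
  · let e := Fintype.equivFin ι
    refine ⟨_, Matrix.reindex e e T, 2, by omega, by rw [weight_reindex, h0],
      fun w => (weight_reindex ..).le, fun ρ => ?_⟩
    rw [labelPermanent, labelPermanent, labelPermanent, labelPermanent_update h0,
      labelPermanent_update h0, map_ofNat, two_mul]
    congr 1 <;> exact permanent_reindex e (T.map _)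
  -- The isolated index with loop 1 is the first switch: turning it on does not change its row. As
  -- `y` occurs at least once, `1 + 3k ≤ 4k`.
  · have hw : ∀ w, (bordered T (fun _ => Sum.inl 0) (fun _ => Sum.inl 0) (Sum.inl 1)).weight
        (labelCount w) = T.weight (labelCount w) := by
      intro w
      simp [weight_bordered]
    obtain ⟨A, hA, hA', hA''⟩ := exists_label_sum_chain (R := R) hh y _ _
      (bordered T (fun _ => Sum.inl 0) (fun _ => Sum.inl 0) (Sum.inl 1)) none none 1 rfl
      (by rintro (_ | j) <;> simp) (by rintro (_ | j) <;> simp) (hw y) _ rfl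
    refine ⟨_, A, 1, ?_, hA, fun w => (hA' w).trans (hw w).le, fun ρ => ?_⟩
    · simp; omega
    · rw [hA'' ρ, map_one, one_mul]
      congr 1
      · simp [labelPermanent, map_bordered, permanent_bordered]
      · simp [labelPermanent, map_bordered, permanent_bordered, updateRow_bordered_none]

theorem exists_label_listBoolSum {h : F} (hh : 2 * h = 1) {ι : Type} [Fintype ι] [DecidableEq ι]
    (T : Matrix ι ι (F ⊕ W)) : ∀ ys : List W,
    ∃ (N : ℕ) (A : Matrix (Fin N) (Fin N) (F ⊕ W)) (c : F),
      N ≤ Fintype.card ι + 4 * (ys.map fun y => T.weight (labelCount y)).sum ∧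
      (∀ y ∈ ys, A.weight (labelCount y) = 0) ∧
      (∀ w, A.weight (labelCount w) ≤ T.weight (labelCount w)) ∧
      ∀ ρ : W → R, algebraMap F R c * A.labelPermanent ρ =
        listBoolSum (fun ρ => T.labelPermanent ρ) ys ρ
  | [] => by
    let e := Fintype.equivFin ι
    refine ⟨_, Matrix.reindex e e T, 1, by simp, by simp,
      fun w => (weight_reindex ..).le, fun ρ => ?_⟩
    rw [map_one, one_mul]
    exact permanent_reindex e (T.map _)
  | y :: ys => by
    obtain ⟨N, A, c, hN, hA, hA', hA''⟩ := exists_label_listBoolSum hh T ys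
    obtain ⟨N', A₂, c', hN', hA₂, hA₂', hA₂''⟩ := exists_label_sum (R := R) hh y A
    refine ⟨N', A₂, c * c', ?_, ?_, fun w => (hA₂' w).trans (hA' w), fun ρ => ?_⟩
    · have := hA' y
      simp only [List.map_cons, List.sum_cons, Fintype.card_fin] at hN' ⊢
      omega
    · intro z hz
      rcases List.mem_cons.1 hz with rfl | hz
      · exact hA₂
      · exact Nat.le_zero.1 ((hA₂' z).trans (hA z hz).le)
    · rw [listBoolSum, ← hA'', ← hA'', ← mul_add, ← hA₂'', map_mul, mul_assoc]

end Elimination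

theorem permanent_map {ι R S : Type*} [Fintype ι] [DecidableEq ι] [CommSemiring R] [CommSemiring S]
    (φ : R →+* S) (M : Matrix ι ι R) : φ M.permanent = (M.map φ).permanent := by
  simp [permanent]

end Matrix

/-! ### Boolean sums of expressions as projections of the permanent. -/

theorem isProjection_permanent {F X : Type*} [Field F] {n : ℕ} {f : MvPolynomial X F}
    (a : Fin n → Fin n → F ⊕ X)
    (h : f = (Matrix.of fun i j => Sum.elim MvPolynomial.C MvPolynomial.X (a i j)).permanent) :
    IsProjection f ((PER F).poly n) := by
  refine ⟨fun p => a p.1 p.2, ?_⟩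
  have := Matrix.permanent_map
    (MvPolynomial.aeval (R := F) fun p : Fin n × Fin n =>
      (Sum.elim MvPolynomial.C MvPolynomial.X (a p.1 p.2) : MvPolynomial X F)).toRingHom
    (Matrix.mvPolynomialX (Fin n) (Fin n) F)
  refine h.trans (Eq.trans ?_ this.symm)
  congr 1
  ext1 i j
  simp

theorem isProjection_permanent_of_tree {F X : Type*} [Field F] (h2 : (2 : F) ≠ 0) {m s : ℕ}
    (t : ArithTree F (X ⊕ Fin m)) (ht : t.ops < s) :
    IsProjection (boolSum (t.eval MvPolynomial.X)) ((PER F).poly (6 * s)) := by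
  classical
  obtain ⟨A, hA, hA'⟩ := Matrix.exists_label_of_tree (R := MvPolynomial X F) t.ops Unit
    (Matrix.of fun _ _ => t) (by simp [Matrix.weight]) _ rfl
  obtain ⟨N, A₂, c, hN, hA₂, -, hA₂'⟩ := Matrix.exists_label_listBoolSum (R := MvPolynomial X F)
    (mul_inv_cancel₀ h2) A ((List.finRange m).map Sum.inr)
  have hsum : (((List.finRange m).map (Sum.inr : _ → X ⊕ Fin m)).map
      fun y => A.weight (Matrix.labelCount y)).sum ≤ t.ops + 1 := by
    rw [List.map_map, ← Fin.sum_univ_def]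
    refine le_trans ?_ (t.sum_occurrences_le (Finset.univ.map ⟨Sum.inr, Sum.inr_injective⟩))
    rw [Finset.sum_map]
    refine Finset.sum_le_sum fun y _ => (hA (Sum.inr y)).trans ?_
    simp [Matrix.weight]
  -- The collected constant `c` becomes the loop of one more isolated index.
  let e : Option (Fin N) ≃ Fin (N + 1) := Fintype.equivFinOfCardEq (by simp)
  let A₃ := Matrix.reindex e e
      (Matrix.bordered A₂ (fun _ => Sum.inl 0) (fun _ => Sum.inl 0) (Sum.inl c))
  -- With `k` operations the size is at most `(1 + k) + 4 (k + 1) + 1 = 5 (k + 1) + 1`, and `1 ≤ k +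
  -- 1 ≤ s`.
  obtain ⟨A₄, hA₄, hA₄'⟩ := Matrix.exists_label_of_le (R := MvPolynomial X F) A₃ (M := 6 * s)
    (by
      have h1 : Fintype.card (Fin (Fintype.card Unit + t.ops)) = 1 + t.ops := by simp
      omega)
  have hcount : ∀ w, A₃.weight (Matrix.labelCount w) = A₂.weight (Matrix.labelCount w) := by
    intro w
    rw [Matrix.weight_reindex]
    simp [Matrix.weight_bordered]
  have hno : ∀ i j y, A₄ i j ≠ Sum.inr (Sum.inr y) := by
    intro i j y hij
    have h0 := hA₂ (Sum.inr y) (by simp)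
    rw [← hcount, ← hA₄, Matrix.weight_eq_zero_iff] at h0
    simpa [hij, Matrix.labelCount] using h0 i j
  -- The summation variables no longer occur, so they may be given the arbitrary value 0.
  have hval : boolSum (t.eval MvPolynomial.X) =
      A₄.labelPermanent (Sum.elim MvPolynomial.X 0 : X ⊕ Fin m → MvPolynomial X F) := by
    rw [hA₄', Matrix.labelPermanent_reindex, Matrix.labelPermanent, Matrix.map_bordered,
      Matrix.permanent_bordered, boolSum_eval]
    have hS := listBoolSum_eq_sum (fun ρ : X ⊕ Fin m → MvPolynomial X F => t.eval ρ)
      (List.nodup_finRange m) List.mem_finRange (Sum.elim MvPolynomial.X 0)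
    have hT : (fun ρ : X ⊕ Fin m → MvPolynomial X F => A.labelPermanent ρ) =
        fun ρ => t.eval ρ := by
      ext1 ρ
      rw [hA']
      simp
    rw [← hT, ← hA₂'] at hS
    simp only [Sum.elim_inl] at hS
    simpa [Matrix.labelPermanent, hA'] using hS.symm
  rw [hval]
  refine isProjection_permanent
    (fun i j => Sum.elim Sum.inl (Sum.elim Sum.inr fun _ => Sum.inl 0) (A₄ i j)) ?_
  rw [Matrix.labelPermanent]
  congr 1
  ext1 i j
  cases hij : A₄ i j with
  | inl a => simp [hij, MvPolynomial.algebraMap_eq]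
  | inr w =>
    cases w with
    | inl x => simp [hij]
    | inr y => exact absurd hij (hno i j y)

/-! ### Formulas as circuits and as expression trees. -/

namespace Gate

variable {F X V W : Type*}

/-- Renaming of the nodes. -/
def map (f : V → W) : Gate F X V → Gate F X W
  | const a => const a
  | var x => var x
  | add l r => add (f l) (f r)
  | mul l r => mul (f l) (f r)

theorem children_map (f : V → W) (g : Gate F X V) : (g.map f).children = g.children.map f := by
  cases g <;> rfl

theorem isOperation_map (f : V → W) (g : Gate F X V) :
    (g.map f).IsOperation ↔ g.IsOperation := by
  cases g <;> rfl

theorem map_map {U : Type*} (f : V → W) (f' : W → U) (g : Gate F X V) :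
    (g.map f).map f' = g.map (f' ∘ f) := by
  cases g <;> rfl

end Gate

section ListMultiplicity

variable {V W : Type*}

open Classical in
/-- The number of occurrences in a list. -/
noncomputable def listMultiplicity (u : V) (L : List V) : ℕ := L.count u

open Classical in
theorem listMultiplicity_pos {u : V} {L : List V} (h : u ∈ L) : 0 < listMultiplicity u L :=
  List.count_pos_iff.2 h

open Classical in
theorem listMultiplicity_eq_zero {u : V} {L : List V} (h : u ∉ L) : listMultiplicity u L = 0 :=
  List.count_eq_zero.2 h

open Classical in
theorem listMultiplicity_map {f : V → W} (hf : Function.Injective f) (u : V) (L : List V) :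
    listMultiplicity (f u) (L.map f) = listMultiplicity u L :=
  List.count_map_of_injective L f hf u

open Classical in
theorem listMultiplicity_pair (u a b : V) :
    listMultiplicity u [a, b] = (if u = a then 1 else 0) + (if u = b then 1 else 0) := by
  simp only [listMultiplicity, List.count_cons, List.count_nil, beq_iff_eq, eq_comm (a := u)]
  omega

theorem nodup_of_listMultiplicity_le_one {L : List V} (h : ∀ u, listMultiplicity u L ≤ 1) :
    L.Nodup := by
  classical
  refine List.nodup_iff_count_le_one.2 fun u => le_trans (le_of_eq ?_) (h u)
  unfold listMultiplicity
  congr!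

end ListMultiplicity

namespace Circuit

theorem outdegree_eq_sum {F X : Type*} (Φ : Circuit F X) (u : Φ.V) :
    Φ.outdegree u = ∑ v, listMultiplicity u (Φ.gate v).children := rfl

section Formula

variable {F X : Type*} {Φ : Circuit F X}

theorem IsFormula.parent_unique (h : Φ.IsFormula) {u w w' : Φ.V} (hw : Φ.Edge u w)
    (hw' : Φ.Edge u w') : w = w' := by
  classical
  by_contra hne
  have h1 := h u
  rw [outdegree_eq_sum, Fintype.sum_eq_add_sum_compl w, ← Finset.add_sum_erase _ _
    (show w' ∈ ({w} : Finset Φ.V)ᶜ by simpa using Ne.symm hne)] at h1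
  have h2 := listMultiplicity_pos hw
  have h3 := listMultiplicity_pos hw'
  omega

theorem IsFormula.children_nodup (h : Φ.IsFormula) (v : Φ.V) : (Φ.gate v).children.Nodup :=
  nodup_of_listMultiplicity_le_one fun u =>
    (Finset.single_le_sum (f := fun v => listMultiplicity u (Φ.gate v).children)
      (fun _ _ => Nat.zero_le _) (Finset.mem_univ v)).trans (h u)

/-- Parents are unique, so the gates above `u` form a chain and one of `l`, `r` lies below the
other. The path between them would have to pass through the common parent `v`, which closes a cycle.
-/
theorem IsFormula.disjoint (h : Φ.IsFormula) {u v l r : Φ.V} (hl : Φ.Edge l v) (hr : Φ.Edge r v)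
    (hne : l ≠ r) (hul : Φ.InSubcircuit u l) (hur : Φ.InSubcircuit u r) : False := by
  have key : ∀ {l r : Φ.V}, Φ.Edge l v → Φ.Edge r v → l ≠ r → ¬ Φ.InSubcircuit l r := by
    intro l r hl hr hne hlr
    rcases Relation.ReflTransGen.cases_head hlr with rfl | ⟨x, hx, hxr⟩
    · exact hne rfl
    · obtain rfl := h.parent_unique hl hx
      exact Φ.acyclic v (Relation.TransGen.tail' hxr hr)
  rcases Relation.ReflTransGen.total_of_right_unique (r := Φ.Edge)
    (fun _ _ _ => h.parent_unique) hul hur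
    with h' | h'
  · exact key hl hr hne h'
  · exact key hr hl hne.symm h'

theorem IsFormula.multiplicativelyDisjoint (h : Φ.IsFormula) : Φ.MultiplicativelyDisjoint := by
  intro v l r hv u hu
  have hn := h.children_nodup v
  simp only [hv, Gate.children, List.nodup_cons, List.mem_singleton] at hn
  exact h.disjoint (v := v) (by simp [Edge, hv, Gate.children]) (by simp [Edge, hv, Gate.children])
    hn.1 hu.1 hu.2

end Formula

/-- Unfolding costs nothing: the subcircuits of two siblings share no gate, so the operation gates
below a gate are counted additively. -/
theorem IsFormula.exists_tree {F X : Type*} [Field F] {Φ : Circuit F X} (h : Φ.IsFormula)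
    {f : MvPolynomial X F} (hf : Φ.Computes f) :
    ∃ t : ArithTree F X, t.eval MvPolynomial.X = f ∧ t.ops ≤ Φ.size := by
  classical
  let S : Φ.V → Set Φ.V := fun v => {u | (Φ.gate u).IsOperation ∧ Φ.InSubcircuit u v}
  have key : ∀ v, ∃ t : ArithTree F X, t.eval MvPolynomial.X = Φ.value v ∧ t.ops ≤ (S v).ncard := by
    intro v
    induction v using Φ.wellFounded_edge.induction with
    | _ v ih =>
      have hbin : ∀ l r, Φ.Edge l v → Φ.Edge r v → l ≠ r → (Φ.gate v).IsOperation →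
          (S l).ncard + (S r).ncard + 1 ≤ (S v).ncard := by
        intro l r hl hr hne hv
        have hd : Disjoint (S l) (S r) := Set.disjoint_left.2 fun u hu hu' =>
          h.disjoint hl hr hne hu.2 hu'.2
        have hvn : v ∉ S l ∪ S r := by
          rintro (hc | hc)
          · exact Φ.acyclic v (Relation.TransGen.tail' hc.2 hl)
          · exact Φ.acyclic v (Relation.TransGen.tail' hc.2 hr)
        rw [← Set.ncard_union_eq hd, ← Set.ncard_insert_of_notMem hvn]
        refine Set.ncard_le_ncard ?_
        rintro u (rfl | hu | hu)
        · exact ⟨hv, Relation.ReflTransGen.refl⟩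
        · exact ⟨hu.1, hu.2.tail hl⟩
        · exact ⟨hu.1, hu.2.tail hr⟩
      have hn := h.children_nodup v
      cases hv : Φ.gate v with
      | const a =>
        refine ⟨.const a, ?_, by simp [ArithTree.ops]⟩
        rw [Φ.value_eq, hv]
        rfl
      | var x =>
        refine ⟨.var x, ?_, by simp [ArithTree.ops]⟩
        rw [Φ.value_eq, hv]
        rfl
      | add l r =>
        simp only [hv, Gate.children, List.nodup_cons, List.mem_singleton] at hn
        have hl : Φ.Edge l v := by simp [Edge, hv, Gate.children]
        have hr : Φ.Edge r v := by simp [Edge, hv, Gate.children]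
        obtain ⟨tl, htl, htl'⟩ := ih l hl
        obtain ⟨tr, htr, htr'⟩ := ih r hr
        refine ⟨.add tl tr, ?_, ?_⟩
        · rw [Φ.value_eq, hv, ArithTree.eval, htl, htr]
        · have := hbin l r hl hr hn.1 (by rw [hv]; trivial)
          rw [ArithTree.ops]
          omega
      | mul l r =>
        simp only [hv, Gate.children, List.nodup_cons, List.mem_singleton] at hn
        have hl : Φ.Edge l v := by simp [Edge, hv, Gate.children]
        have hr : Φ.Edge r v := by simp [Edge, hv, Gate.children]
        obtain ⟨tl, htl, htl'⟩ := ih l hl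
        obtain ⟨tr, htr, htr'⟩ := ih r hr
        refine ⟨.mul tl tr, ?_, ?_⟩
        · rw [Φ.value_eq, hv, ArithTree.eval, htl, htr]
        · have := hbin l r hl hr hn.1 (by rw [hv]; trivial)
          rw [ArithTree.ops]
          omega
  obtain ⟨v, rfl⟩ := hf
  obtain ⟨t, ht, ht'⟩ := key v
  refine ⟨t, ht, ht'.trans ?_⟩
  exact Set.ncard_le_ncard (t := {u | (Φ.gate u).IsOperation}) fun u hu => hu.1

end Circuit

/-- Two families of gates side by side, with one further gate. -/
def joinGates {F Z A B : Type*} (g : Gate F Z (Option (A ⊕ B))) (a : A → Gate F Z A)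
    (b : B → Gate F Z B) : Option (A ⊕ B) → Gate F Z (Option (A ⊕ B))
  | none => g
  | some (Sum.inl x) => (a x).map fun y => some (Sum.inl y)
  | some (Sum.inr x) => (b x).map fun y => some (Sum.inr y)

open Classical in
/-- The node `o` is the root of a tree of gates in which all the nodes lie. -/
structure IsTree {F Z V : Type*} [Fintype V] (gate : V → Gate F Z V) (o : V) (k : ℕ) : Prop where
  exists_rank : ∃ rank : V → ℕ, (∀ v, rank v ≤ rank o) ∧
    ∀ u v, u ∈ (gate v).children → rank u < rank v
  sum_count : ∀ u, ∑ v, listMultiplicity u (gate v).children = if u = o then 0 else 1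
  sum_operation : ∑ v, (if (gate v).IsOperation then 1 else 0) = k

theorem isTree_of_children_eq_nil {F Z : Type*} (g : Gate F Z Unit) (hg : g.children = [])
    (hg' : ¬ g.IsOperation) : IsTree (fun _ => g) () 0 where
  exists_rank := ⟨fun _ => 0, by simp, by simp [hg]⟩
  sum_count := by simp [hg, listMultiplicity]
  sum_operation := by simp [hg']

open Classical in
theorem IsTree.join {F Z A B : Type*} [Fintype A] [Fintype B] {a : A → Gate F Z A}
    {b : B → Gate F Z B} {o : A} {o' : B} {k k' : ℕ} (ha : IsTree a o k) (hb : IsTree b o' k')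
    {g : Gate F Z (Option (A ⊕ B))} (hg : g.children = [some (Sum.inl o), some (Sum.inr o')])
    (hg' : g.IsOperation) : IsTree (joinGates g a b) none (k + k' + 1) where
  exists_rank := by
    obtain ⟨p, hp, hp'⟩ := ha.exists_rank
    obtain ⟨q, hq, hq'⟩ := hb.exists_rank
    refine ⟨fun v => v.elim (p o + q o' + 1) (Sum.elim p q), ?_, ?_⟩
    · rintro (_ | v | v)
      · exact le_rfl
      · have := hp v
        simp only [Option.elim, Sum.elim_inl]
        omega
      · have := hq v
        simp only [Option.elim, Sum.elim_inr]
        omega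
    · rintro u (_ | v | v) hu
      · simp only [joinGates, hg, List.mem_cons, List.not_mem_nil, or_false] at hu
        rcases hu with rfl | rfl
        · simp only [Option.elim, Sum.elim_inl]
          omega
        · simp only [Option.elim, Sum.elim_inr]
          omega
      · rw [joinGates, Gate.children_map, List.mem_map] at hu
        obtain ⟨x, hx, rfl⟩ := hu
        exact hp' x v hx
      · rw [joinGates, Gate.children_map, List.mem_map] at hu
        obtain ⟨x, hx, rfl⟩ := hu
        exact hq' x v hx
  sum_count := by
    have hl : Function.Injective fun y : A => (some (Sum.inl y) : Option (A ⊕ B)) :=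
      (Option.some_injective _).comp Sum.inl_injective
    have hr : Function.Injective fun y : B => (some (Sum.inr y) : Option (A ⊕ B)) :=
      (Option.some_injective _).comp Sum.inr_injective
    intro u
    rw [Fintype.sum_option, Fintype.sum_sum_type]
    simp only [joinGates, Gate.children_map, hg, listMultiplicity_pair]
    rcases u with _ | u | u
    · rw [Finset.sum_eq_zero fun v _ => listMultiplicity_eq_zero (by simp),
        Finset.sum_eq_zero fun v _ => listMultiplicity_eq_zero (by simp)]
      simp
    · rw [Finset.sum_congr rfl fun v _ => listMultiplicity_map hl u _, ha.sum_count,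
        Finset.sum_eq_zero fun v _ => listMultiplicity_eq_zero (by simp)]
      by_cases hu : u = o <;> simp [hu]
    · rw [Finset.sum_congr (s₁ := (Finset.univ : Finset B)) rfl
          fun v _ => listMultiplicity_map hr u _, hb.sum_count,
        Finset.sum_eq_zero fun v _ => listMultiplicity_eq_zero (by simp)]
      by_cases hu : u = o' <;> simp [hu]
  sum_operation := by
    rw [Fintype.sum_option, Fintype.sum_sum_type]
    simp only [joinGates, Gate.isOperation_map, hg', if_true, ha.sum_operation, hb.sum_operation]
    omega

/-- The circuit formed by a tree of gates. -/
def IsTree.toCircuit {F Z : Type*} {V : Type} [Fintype V] {gate : V → Gate F Z V} {o : V} {k : ℕ}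
    (h : IsTree gate o k) : Circuit F Z where
  V := V
  gate := gate
  acyclic := by
    obtain ⟨rank, -, hr⟩ := h.exists_rank
    have key : ∀ u v, Relation.TransGen (fun u w => u ∈ (gate w).children) u v →
        rank u < rank v := by
      intro u v huv
      induction huv with
      | single h => exact hr _ _ h
      | tail _ h ih => exact ih.trans (hr _ _ h)
    exact fun v hv => lt_irrefl _ (key v v hv)

/-- The value is asserted for every copy of the gates inside any circuit, so that the induction
hypotheses apply to the two subtrees inside the joined one. -/
theorem ArithTree.exists_isTree {F Z : Type*} [Field F] (t : ArithTree F Z) :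
    ∃ (V : Type) (_ : Fintype V) (gate : V → Gate F Z V) (o : V), IsTree gate o t.ops ∧
      ∀ (Φ : Circuit F Z) (f : V → Φ.V), (∀ x, Φ.gate (f x) = (gate x).map f) →
        Φ.value (f o) = t.eval MvPolynomial.X := by
  induction t with
  | const a =>
    refine ⟨Unit, inferInstance, fun _ => Gate.const a, (),
      isTree_of_children_eq_nil _ rfl id, fun Φ f hf => ?_⟩
    rw [Φ.value_eq, hf]
    rfl
  | var z =>
    refine ⟨Unit, inferInstance, fun _ => Gate.var z, (),
      isTree_of_children_eq_nil _ rfl id, fun Φ f hf => ?_⟩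
    rw [Φ.value_eq, hf]
    rfl
  | add l r hl hr =>
    obtain ⟨A, _, a, o, ha, ha'⟩ := hl
    obtain ⟨B, _, b, o', hb, hb'⟩ := hr
    refine ⟨Option (A ⊕ B), inferInstance, _, none,
      ha.join hb (g := Gate.add (some (Sum.inl o)) (some (Sum.inr o'))) rfl trivial,
      fun Φ f hf => ?_⟩
    rw [Φ.value_eq, hf, eval,
      ← ha' Φ (fun y => f (some (Sum.inl y))) fun x => (hf _).trans (Gate.map_map ..),
      ← hb' Φ (fun y => f (some (Sum.inr y))) fun x => (hf _).trans (Gate.map_map ..)]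
    rfl
  | mul l r hl hr =>
    obtain ⟨A, _, a, o, ha, ha'⟩ := hl
    obtain ⟨B, _, b, o', hb, hb'⟩ := hr
    refine ⟨Option (A ⊕ B), inferInstance, _, none,
      ha.join hb (g := Gate.mul (some (Sum.inl o)) (some (Sum.inr o'))) rfl trivial,
      fun Φ f hf => ?_⟩
    rw [Φ.value_eq, hf, eval,
      ← ha' Φ (fun y => f (some (Sum.inl y))) fun x => (hf _).trans (Gate.map_map ..),
      ← hb' Φ (fun y => f (some (Sum.inr y))) fun x => (hf _).trans (Gate.map_map ..)]
    rfl

theorem ArithTree.exists_formula {F Z : Type*} [Field F] (t : ArithTree F Z) :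
    ∃ Φ : Circuit F Z, Φ.IsFormula ∧ Φ.Computes (t.eval MvPolynomial.X) ∧ Φ.size = t.ops := by
  classical
  obtain ⟨V, _, gate, o, h, hv⟩ := t.exists_isTree
  refine ⟨h.toCircuit, fun u => ?_, ⟨o, hv h.toCircuit id fun x => ?_⟩, ?_⟩
  · refine (h.sum_count u).le.trans ?_
    split <;> simp
  · change gate x = (gate x).map id
    cases gate x <;> rfl
  · refine Eq.trans ?_ h.sum_operation
    rw [Circuit.size, Nat.card_eq_fintype_card, Fintype.card_subtype,
      Finset.card_filter]
    rfl

/-! ### Parse trees: multiplicatively disjoint circuits as Boolean sums of expressions. -/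

section BoolSum

variable {W R : Type*} [DecidableEq W] [CommRing R]

theorem listBoolSum_append (h : (W → R) → R) : ∀ (ys zs : List W) (ρ : W → R),
    listBoolSum h (ys ++ zs) ρ = listBoolSum (listBoolSum h zs) ys ρ
  | [], zs, ρ => rfl
  | y :: ys, zs, ρ => by
    rw [List.cons_append, listBoolSum, listBoolSum, listBoolSum_append h ys,
      listBoolSum_append h ys]

theorem listBoolSum_map {U : Type*} [DecidableEq U] {f : U → W} (hf : Function.Injective f)
    (h : (U → R) → R) : ∀ (ys : List U) (ρ : W → R),
    listBoolSum (fun ρ => h (ρ ∘ f)) (ys.map f) ρ = listBoolSum h ys (ρ ∘ f)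
  | [], ρ => rfl
  | y :: ys, ρ => by
    rw [List.map_cons, listBoolSum, listBoolSum, listBoolSum_map hf h ys, listBoolSum_map hf h ys,
      Function.update_comp_eq_of_injective _ hf, Function.update_comp_eq_of_injective _ hf]

end BoolSum

namespace ArithTree

variable {F Z : Type*} [CommRing F]

/-- The expression `1 - t`. -/
def compl (t : ArithTree F Z) : ArithTree F Z := add (const 1) (mul (const (-1)) t)

theorem ops_compl (t : ArithTree F Z) : t.compl.ops = t.ops + 2 := by
  simp [compl, ops]

theorem eval_compl {R : Type*} [CommRing R] [Algebra F R] (ρ : Z → R) (t : ArithTree F Z) :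
    t.compl.eval ρ = 1 - t.eval ρ := by
  simp [compl, eval]
  ring

instance : Mul (ArithTree F Z) := ⟨mul⟩

end ArithTree

namespace Circuit

section Topological

variable {F Z : Type*} (Φ : Circuit F Z)

/-- The children of every gate in the list occur after it. -/
def IsTopological : List Φ.V → Prop
  | [] => True
  | v :: L => v ∉ L ∧ (∀ u, Φ.Edge u v → u ∈ L) ∧ IsTopological L

/-- A gate of `S` that is no child of a gate of `S` is put first; the others remain closed under
children. -/
theorem exists_isTopological [DecidableEq Φ.V] (n : ℕ) : ∀ S : Finset Φ.V, S.card = n →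
    (∀ v ∈ S, ∀ u, Φ.Edge u v → u ∈ S) → ∃ L : List Φ.V, Φ.IsTopological L ∧
      L.length = n ∧ ∀ v, v ∈ L ↔ v ∈ S := by
  induction n with
  | zero =>
    intro S hS _
    rw [Finset.card_eq_zero] at hS
    exact ⟨[], trivial, rfl, by simp [hS]⟩
  | succ n ih =>
    intro S hS hc
    have : Std.Irrefl (Relation.TransGen (Function.swap Φ.Edge)) :=
      ⟨fun v hv => Φ.acyclic v (Relation.transGen_swap.1 hv)⟩
    have hwf : WellFounded (Relation.TransGen (Function.swap Φ.Edge)) :=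
      Finite.wellFounded_of_trans_of_irrefl _
    obtain ⟨m, hm, hmin⟩ := hwf.has_min (S : Set Φ.V)
      (Finset.coe_nonempty.2 (Finset.card_pos.1 (by omega)))
    obtain ⟨L, hL, hlen, hmem⟩ := ih (S.erase m) (by rw [Finset.card_erase_of_mem hm, hS]; rfl)
      (by
        intro v hv u hu
        rw [Finset.mem_erase] at hv ⊢
        refine ⟨?_, hc v hv.2 u hu⟩
        rintro rfl
        exact hmin v hv.2 (Relation.TransGen.single hu))
    refine ⟨m :: L, ⟨?_, fun u hu => ?_, hL⟩, by simp [hlen], fun v => ?_⟩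
    · simp [hmem]
    · rw [hmem, Finset.mem_erase]
      refine ⟨?_, hc m hm u hu⟩
      rintro rfl
      exact Φ.acyclic u (Relation.TransGen.single hu)
    · rw [List.mem_cons, hmem, Finset.mem_erase]
      by_cases hv : v = m
      · simp [hv, show m ∈ S from hm]
      · simp [hv]

end Topological

section Parse

open Classical in
/-- The effect of a gate on the marks of its children: the mark of a child is multiplied by the bit
of the edge that leads to it. -/
noncomputable def passMarks {F Z V A : Type*} [Mul A] (g : Gate F Z V) (c : V → A) (p q : A) :
    V → A :=
  match g with
  | Gate.const _ => c
  | Gate.var _ => c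
  | Gate.add l r | Gate.mul l r =>
    Function.update (Function.update c l (c l * p)) r (Function.update c l (c l * p) r * q)

/-- The local condition at a gate with mark `c`, whose two incoming edges have the bits `p` and `q`.
A mark or a bit is zero if the gate or the edge belongs to the parse tree. -/
def localValue {F Z V R : Type*} [CommRing F] [CommRing R] [Algebra F R] (lam : Z → R)
    (g : Gate F Z V) (c p q : R) : R :=
  c * p * q + (1 - c) *
    match g with
    | Gate.const a => algebraMap F R a * (p * q)
    | Gate.var z => lam z * (p * q)
    | Gate.add _ _ => p * (1 - q) + (1 - p) * q
    | Gate.mul _ _ => (1 - p) * (1 - q)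

/-- The expression for the local condition. -/
def localTree {F Z V W : Type*} [CommRing F] (emb : Z → W) (g : Gate F Z V)
    (c p q : ArithTree F W) : ArithTree F W :=
  .add (.mul (.mul c p) q) (.mul c.compl
    (match g with
    | Gate.const a => .mul (.const a) (.mul p q)
    | Gate.var z => .mul (.var (emb z)) (.mul p q)
    | Gate.add _ _ => .add (.mul p q.compl) (.mul p.compl q)
    | Gate.mul _ _ => .mul p.compl q.compl))

theorem eval_localTree {F Z V W R : Type*} [CommRing F] [CommRing R] [Algebra F R] (emb : Z → W)
    (g : Gate F Z V) (c p q : ArithTree F W) (ρ : W → R) :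
    (localTree emb g c p q).eval ρ =
      localValue (ρ ∘ emb) g (c.eval ρ) (p.eval ρ) (q.eval ρ) := by
  cases g <;> simp [localTree, localValue, ArithTree.eval, ArithTree.eval_compl]

theorem ops_localTree_le {F Z V W : Type*} [CommRing F] (emb : Z → W)
    (g : Gate F Z V) (c : ArithTree F W) (x y : W) :
    (localTree emb g c (.var x) (.var y)).ops ≤ 2 * c.ops + 13 := by
  cases g <;> simp [localTree, ArithTree.ops, ArithTree.ops_compl] <;> omega

theorem eval_passMarks {F Z V W R : Type*} [CommRing F] [CommRing R] [Algebra F R]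
    (g : Gate F Z V) (c : V → ArithTree F W) (p q : ArithTree F W) (ρ : W → R) :
    (fun v => (passMarks g c p q v).eval ρ) =
      passMarks g (fun v => (c v).eval ρ) (p.eval ρ) (q.eval ρ) := by
  have hm : ∀ s t : ArithTree F W, (s * t).eval ρ = s.eval ρ * t.eval ρ := fun _ _ => rfl
  ext v
  cases g with
  | const a => rfl
  | var z => rfl
  | add l r | mul l r =>
    simp only [passMarks, Function.update_apply]
    split_ifs <;> simp [*]

/-- With 0 meaning membership, "some incoming edge is chosen" is a product of bits. So a mark grows
by at most two operations per gate, which makes the whole expression quadratic. -/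
theorem ops_passMarks_le {F Z V W : Type*} [CommRing F] (g : Gate F Z V) (c : V → ArithTree F W)
    (x y : W) (v : V) :
    (passMarks g c (.var x) (.var y) v).ops ≤ (c v).ops + 2 := by
  have hm : ∀ s t : ArithTree F W, (s * t).ops = s.ops + t.ops + 1 := fun _ _ => rfl
  cases g with
  | const a => simp [passMarks]
  | var z => simp [passMarks]
  | add l r | mul l r =>
    simp only [passMarks, Function.update_apply]
    split_ifs <;> simp [ArithTree.ops, *]

open Classical in
theorem passMarks_apply {F Z V R : Type*} [CommRing R] (g : Gate F Z V) (c : V → R) {l r : V}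
    (hg : g.children = [l, r]) (p q : R) (w : V) : passMarks g c p q w =
      c w * (if w = l then p else 1) * (if w = r then q else 1) := by
  cases g with
  | const a => simp [Gate.children] at hg
  | var z => simp [Gate.children] at hg
  | add l' r' | mul l' r' =>
    simp only [Gate.children, List.cons.injEq, and_true] at hg
    obtain ⟨rfl, rfl⟩ := hg
    simp only [passMarks, Function.update_apply]
    split_ifs <;> simp_all

variable {F Z W : Type*} [Field F] (Φ : Circuit F Z) (emb : Z → W) (bit : ℕ → W)

/-- The expression that, summed over all values of the bits, gives the product of the polynomials
at the gates that are marked by zero. -/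
noncomputable def parseTree : List Φ.V → (Φ.V → ArithTree F W) → ArithTree F W
  | [], _ => .const 1
  | v :: L, c => .mul
      (localTree emb (Φ.gate v) (c v) (.var (bit (2 * L.length))) (.var (bit (2 * L.length + 1))))
      (parseTree L
        (passMarks (Φ.gate v) c (.var (bit (2 * L.length))) (.var (bit (2 * L.length + 1)))))

/-- The value of the expression `parseTree`. -/
noncomputable def parseValue {R : Type*} [CommRing R] [Algebra F R] (ρ : W → R) :
    List Φ.V → (Φ.V → R) → R
  | [], _ => 1
  | v :: L, c =>
      localValue (ρ ∘ emb) (Φ.gate v) (c v) (ρ (bit (2 * L.length))) (ρ (bit (2 * L.length + 1))) *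
      parseValue ρ L (passMarks (Φ.gate v) c (ρ (bit (2 * L.length))) (ρ (bit (2 * L.length + 1))))

theorem eval_parseTree {R : Type*} [CommRing R] [Algebra F R] (ρ : W → R) :
    ∀ (L : List Φ.V) (c : Φ.V → ArithTree F W),
    (Φ.parseTree emb bit L c).eval ρ = Φ.parseValue emb bit ρ L fun v => (c v).eval ρ
  | [], c => by simp [parseTree, parseValue, ArithTree.eval]
  | v :: L, c => by
    rw [parseTree, parseValue, ArithTree.eval, eval_localTree, eval_parseTree ρ L, eval_passMarks]
    rfl

theorem ops_parseTree_le : ∀ (L : List Φ.V) (c : Φ.V → ArithTree F W) (b : ℕ),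
    (∀ v, (c v).ops ≤ b) →
    (Φ.parseTree emb bit L c).ops ≤ L.length * (2 * (b + 2 * L.length) + 14)
  | [], c, b, hb => by simp [parseTree, ArithTree.ops]
  | v :: L, c, b, hb => by
    have h1 := ops_parseTree_le L
      (passMarks (Φ.gate v) c (.var (bit (2 * L.length))) (.var (bit (2 * L.length + 1)))) (b + 2)
      fun w => (ops_passMarks_le ..).trans (Nat.add_le_add_right (hb w) 2)
    have h2 := ops_localTree_le emb (Φ.gate v) (c v) (bit (2 * L.length)) (bit (2 * L.length + 1))
    have h3 := hb v
    rw [parseTree, ArithTree.ops, List.length_cons]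
    nlinarith

/-- The indices of the bits for a list of `n` gates. -/
def bitList : ℕ → List W
  | 0 => []
  | n + 1 => bit (2 * n) :: bit (2 * n + 1) :: bitList n

theorem mem_bitList {w : W} : ∀ {n : ℕ}, w ∈ bitList bit n ↔ ∃ i < 2 * n, bit i = w
  | 0 => by simp [bitList]
  | n + 1 => by
    rw [bitList, List.mem_cons, List.mem_cons, mem_bitList]
    constructor
    · rintro (rfl | rfl | ⟨i, hi, rfl⟩)
      · exact ⟨_, by omega, rfl⟩
      · exact ⟨_, by omega, rfl⟩
      · exact ⟨i, by omega, rfl⟩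
    · rintro ⟨i, hi, rfl⟩
      by_cases h1 : i = 2 * n
      · exact Or.inl (by rw [h1])
      by_cases h2 : i = 2 * n + 1
      · exact Or.inr (Or.inl (by rw [h2]))
      · exact Or.inr (Or.inr ⟨i, by omega, rfl⟩)

theorem nodup_bitList : ∀ {n : ℕ}, Set.InjOn bit (Set.Iio (2 * n)) → (bitList bit n).Nodup
  | 0, _ => List.nodup_nil
  | n + 1, h => by
    rw [bitList, List.nodup_cons, List.nodup_cons, List.mem_cons, mem_bitList, mem_bitList]
    refine ⟨?_, ?_, nodup_bitList (h.mono fun i hi => ?_)⟩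
    · rintro (h' | ⟨i, hi, h'⟩)
      · have := h (Set.mem_Iio.2 (by omega)) (Set.mem_Iio.2 (by omega)) h'
        omega
      · have := h (Set.mem_Iio.2 (by omega)) (Set.mem_Iio.2 (by omega)) h'
        omega
    · rintro ⟨i, hi, h'⟩
      have := h (Set.mem_Iio.2 (by omega)) (Set.mem_Iio.2 (by omega)) h'
      omega
    · simp only [Set.mem_Iio] at hi ⊢
      omega

end Parse

end Circuit

namespace Circuit

variable {F Z W : Type*} [Field F] (Φ : Circuit F Z) (emb : Z → W) (bit : ℕ → W)

/-- The two bits of the first gate are fixed in the four possible ways; the remaining bits do not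
affect its local factor, which leaves the inner sum. -/
theorem listBoolSum_parseValue_cons [DecidableEq W] {R : Type*} [CommRing R] [Algebra F R]
    {v : Φ.V} {L : List Φ.V} (hinj : Set.InjOn bit (Set.Iio (2 * (L.length + 1))))
    (hemb : ∀ z, ∀ i < 2 * (L.length + 1), emb z ≠ bit i) (c : Φ.V → R) (ρ : W → R) :
    ∃ σ : R → R → W → R, (∀ p q, σ p q ∘ emb = ρ ∘ emb) ∧
      let T := fun p q => localValue (ρ ∘ emb) (Φ.gate v) (c v) p q *
        listBoolSum (fun ρ => Φ.parseValue emb bit ρ L (passMarks (Φ.gate v) c p q))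
          (bitList bit L.length) (σ p q)
      listBoolSum (fun ρ => Φ.parseValue emb bit ρ (v :: L) c)
        (bitList bit (L.length + 1)) ρ = T 0 0 + T 0 1 + (T 1 0 + T 1 1) := by
  have hne : bit (2 * L.length) ≠ bit (2 * L.length + 1) := fun h => by
    have := hinj (Set.mem_Iio.2 (by omega)) (Set.mem_Iio.2 (by omega)) h
    omega
  have h0 : bit (2 * L.length) ∉ bitList bit L.length := by
    rw [mem_bitList]
    rintro ⟨i, hi, h⟩
    have := hinj (Set.mem_Iio.2 (by omega)) (Set.mem_Iio.2 (by omega)) h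
    omega
  have h1 : bit (2 * L.length + 1) ∉ bitList bit L.length := by
    rw [mem_bitList]
    rintro ⟨i, hi, h⟩
    have := hinj (Set.mem_Iio.2 (by omega)) (Set.mem_Iio.2 (by omega)) h
    omega
  have he : ∀ z, emb z ∉ bitList bit L.length := by
    intro z
    rw [mem_bitList]
    rintro ⟨i, hi, h⟩
    exact hemb z i (by omega) h.symm
  let σ : R → R → W → R := fun p q =>
    Function.update (Function.update ρ (bit (2 * L.length)) p) (bit (2 * L.length + 1)) q
  have hσ : ∀ p q, σ p q ∘ emb = ρ ∘ emb := by
    intro p q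
    ext z
    simp only [σ, Function.comp]
    rw [Function.update_of_ne (hemb z _ (by omega)), Function.update_of_ne (hemb z _ (by omega))]
  refine ⟨σ, hσ, ?_⟩
  have key : ∀ p q, listBoolSum (fun ρ => Φ.parseValue emb bit ρ (v :: L) c)
      (bitList bit L.length) (σ p q) = localValue (ρ ∘ emb) (Φ.gate v) (c v) p q *
        listBoolSum (fun ρ => Φ.parseValue emb bit ρ L (passMarks (Φ.gate v) c p q))
          (bitList bit L.length) (σ p q) := by
    intro p q
    rw [← listBoolSum_mul_left]
    refine listBoolSum_congr _ _ fun ρ' hρ' => ?_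
    have e0 : ρ' (bit (2 * L.length)) = p := by
      rw [hρ' _ h0]
      simp [σ, hne]
    have e1 : ρ' (bit (2 * L.length + 1)) = q := by
      rw [hρ' _ h1]
      simp [σ]
    have e2 : ρ' ∘ emb = ρ ∘ emb := by
      rw [← hσ p q]
      ext z
      exact hρ' _ (he z)
    rw [parseValue, e0, e1, e2]
  simp only [bitList, listBoolSum, ← key]
  rfl

/-- Summed over all values of the bits, the expression `parseValue` gives the product of the
polynomials at the gates marked by zero, if these gates have disjoint subcircuits. -/
theorem listBoolSum_parseValue [DecidableEq W] [DecidableEq Φ.V]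
    (hΦ : Φ.MultiplicativelyDisjoint) {R : Type*} [CommRing R]
    [Algebra F R] : ∀ (L : List Φ.V), Φ.IsTopological L →
    Set.InjOn bit (Set.Iio (2 * L.length)) → (∀ z, ∀ i < 2 * L.length, emb z ≠ bit i) →
    ∀ (A : Finset Φ.V), (∀ a ∈ A, a ∈ L) →
    (A : Set Φ.V).PairwiseDisjoint (fun a => {u | Φ.InSubcircuit u a}) →
    ∀ (c : Φ.V → R), (∀ w ∈ L, c w = if w ∈ A then 0 else 1) → ∀ ρ : W → R,
    listBoolSum (fun ρ => Φ.parseValue emb bit ρ L c) (bitList bit L.length) ρ =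
      ∏ a ∈ A, MvPolynomial.aeval (ρ ∘ emb) (Φ.value a)
  | [], _, _, _, A, hA, _, c, hc, ρ => by
    have : A = ∅ := Finset.eq_empty_of_forall_notMem fun a ha => by simpa using hA a ha
    simp [this, listBoolSum, bitList, parseValue]
  | v :: L, hL, hinj, hemb, A, hA, hd, c, hc, ρ => by
    obtain ⟨hvL, hchild, hL⟩ := hL
    rw [List.length_cons] at hinj hemb
    obtain ⟨σ, hσ, hsum⟩ := Φ.listBoolSum_parseValue_cons emb bit (v := v) hinj hemb c ρ
    have ih : ∀ A' : Finset Φ.V, (∀ a ∈ A', a ∈ L) →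
        (A' : Set Φ.V).PairwiseDisjoint (fun a => {u | Φ.InSubcircuit u a}) → ∀ p q : R,
        (∀ w ∈ L, passMarks (Φ.gate v) c p q w = if w ∈ A' then 0 else 1) →
        listBoolSum (fun ρ => Φ.parseValue emb bit ρ L (passMarks (Φ.gate v) c p q))
          (bitList bit L.length) (σ p q) = ∏ a ∈ A', MvPolynomial.aeval (ρ ∘ emb) (Φ.value a) := by
      intro A' h1 h2 p q h3
      rw [listBoolSum_parseValue hΦ L hL (hinj.mono fun i hi => by
        simp only [Set.mem_Iio] at hi ⊢; omega) (fun z i hi => hemb z i (by omega)) A' h1 h2 _ h3,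
        hσ]
    rw [List.length_cons, hsum]
    have hcv := hc v (by simp)
    have hcL : ∀ w ∈ L, c w = if w ∈ A then 0 else 1 := fun w hw => hc w (by simp [hw])
    -- A gate of the parse tree is replaced in `A` by its chosen children. Their subcircuits lie in
    -- that of `v`, so they stay disjoint from those of the other members of `A`.
    by_cases hv : v ∈ A
    · rw [if_pos hv] at hcv
      have hne : ∀ w ∈ L, w ≠ v := fun w hw h => hvL (h ▸ hw)
      have hAe : ∀ a ∈ A.erase v, a ∈ L := fun a ha => by
        rw [Finset.mem_erase] at ha
        exact (List.mem_cons.1 (hA a ha.2)).resolve_left ha.1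
      have hde : ((A.erase v : Finset Φ.V) : Set Φ.V).PairwiseDisjoint
          (fun a => {u | Φ.InSubcircuit u a}) := hd.subset (by simp)
      have hsub : ∀ l, Φ.Edge l v → ∀ a ∈ A.erase v,
          Disjoint {u | Φ.InSubcircuit u l} {u | Φ.InSubcircuit u a} := by
        intro l hl a ha
        rw [Finset.mem_erase] at ha
        refine (hd hv ha.2 (Ne.symm ha.1)).mono_left fun u hu => ?_
        exact Relation.ReflTransGen.tail hu hl
      have hnot : ∀ l, Φ.Edge l v → l ∉ A.erase v := fun l hl h =>
        Set.disjoint_left.1 (hsub l hl l h) Relation.ReflTransGen.refl Relation.ReflTransGen.refl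
      have hdi : ∀ l, Φ.Edge l v → ((insert l (A.erase v) : Finset Φ.V) : Set Φ.V).PairwiseDisjoint
          (fun a => {u | Φ.InSubcircuit u a}) := by
        intro l hl
        rw [Finset.coe_insert]
        exact hde.insert fun a ha _ => hsub l hl a ha
      rw [← Finset.mul_prod_erase A _ hv]
      cases hg : Φ.gate v with
      | const a =>
        rw [hg] at ih
        have h11 := ih (A.erase v) hAe hde 1 1 fun w hw => by
          simp [passMarks, hcL w hw, hne w hw]
        simp [localValue, hcv, h11, Φ.value_eq v, hg]
      | var z =>
        rw [hg] at ih
        have h11 := ih (A.erase v) hAe hde 1 1 fun w hw => by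
          simp [passMarks, hcL w hw, hne w hw]
        simp [localValue, hcv, h11, Φ.value_eq v, hg]
      | add l r =>
        have hl : Φ.Edge l v := by simp [Edge, hg, Gate.children]
        have hr : Φ.Edge r v := by simp [Edge, hg, Gate.children]
        rw [hg] at ih
        -- The bits `(0, 1)` choose `l` and `(1, 0)` choose `r`; the other two pairs have local
        -- value 0. This also counts `l = r` twice, as it should.
        have h01 := ih (insert l (A.erase v))
          (by simpa [hchild l hl] using fun a h1 h2 => hAe a (by simp [h1, h2])) (hdi l hl) 0 1
          fun w hw => by
            rw [passMarks_apply _ _ rfl, hcL w hw]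
            by_cases hwl : w = l <;> simp [hwl, hne w hw]
        have h10 := ih (insert r (A.erase v))
          (by simpa [hchild r hr] using fun a h1 h2 => hAe a (by simp [h1, h2])) (hdi r hr) 1 0
          fun w hw => by
            rw [passMarks_apply _ _ rfl, hcL w hw]
            by_cases hwl : w = r <;> simp [hwl, hne w hw]
        rw [Finset.prod_insert (hnot l hl)] at h01
        rw [Finset.prod_insert (hnot r hr)] at h10
        simp [localValue, hcv, h01, h10, Φ.value_eq v, hg]
        ring
      | mul l r =>
        have hl : Φ.Edge l v := by simp [Edge, hg, Gate.children]
        have hr : Φ.Edge r v := by simp [Edge, hg, Gate.children]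
        have hlr := hΦ v l r hg
        have hlr' : Disjoint {u | Φ.InSubcircuit u l} {u | Φ.InSubcircuit u r} :=
          Set.disjoint_left.2 fun u h1 h2 => hlr u ⟨h1, h2⟩
        have hlne : l ≠ r := by
          rintro rfl
          exact hlr l ⟨Relation.ReflTransGen.refl, Relation.ReflTransGen.refl⟩
        rw [hg] at ih
        -- Only the bits `(0, 0)` survive. Multiplicative disjointness is what keeps the subcircuits
        -- of `l` and `r` apart.
        have h00 := ih (insert l (insert r (A.erase v)))
          (by simpa [hchild l hl, hchild r hr] using fun a h1 h2 => hAe a (by simp [h1, h2]))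
          (by
            rw [Finset.coe_insert]
            refine (hdi r hr).insert fun a ha _ => ?_
            rcases Finset.mem_insert.1 ha with rfl | ha
            · exact hlr'
            · exact hsub l hl a ha) 0 0
          fun w hw => by
            rw [passMarks_apply _ _ rfl, hcL w hw]
            by_cases hwl : w = l
            · simp [hwl]
            · by_cases hwr : w = r <;> simp [hwl, hwr, hne w hw]
        rw [Finset.prod_insert (by simp [hlne, hnot l hl]), Finset.prod_insert (hnot r hr)] at h00
        simp [localValue, hcv, h00, Φ.value_eq v, hg]
        ring
    · rw [if_neg hv] at hcv
      -- Outside the parse tree both bits are forced to be 1, so each parse tree has exactly one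
      -- code.
      have h11 := ih A (fun a ha => (List.mem_cons.1 (hA a ha)).resolve_left fun h => hv (h ▸ ha))
        hd 1 1 fun w hw => by
          rw [← hcL w hw]
          cases hg : Φ.gate v with
          | const a => rfl
          | var z => rfl
          | add l r | mul l r =>
            rw [passMarks_apply _ _ rfl]
            simp
      simp [localValue, hcv, h11]

end Circuit

theorem bitList_comp {W W' : Type*} (f : W → W') (bit : ℕ → W) : ∀ n,
    Circuit.bitList (f ∘ bit) n = (Circuit.bitList bit n).map f
  | 0 => rfl
  | n + 1 => by simp [Circuit.bitList, bitList_comp f bit n]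

namespace Circuit

/-- The size does not count input gates, which may be arbitrarily many. Only `o`, the operation
gates and their children are kept. -/
theorem exists_topological_list {F Z : Type*} (Φ : Circuit F Z) (o : Φ.V) :
    ∃ L : List Φ.V, Φ.IsTopological L ∧ o ∈ L ∧ L.length ≤ 3 * Φ.size + 1 := by
  classical
  let ops : Finset Φ.V := Finset.univ.filter fun v => (Φ.gate v).IsOperation
  let S : Finset Φ.V := insert o (ops ∪ ops.biUnion fun v => (Φ.gate v).children.toFinset)
  have hops : ops.card = Φ.size := by
    rw [size, Nat.card_eq_fintype_card, Fintype.card_subtype]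
  have hS : S.card ≤ 3 * Φ.size + 1 := by
    have h1 : (ops.biUnion fun v => (Φ.gate v).children.toFinset).card ≤ ops.card * 2 := by
      refine Finset.card_biUnion_le_card_mul _ _ _ fun v _ => (List.toFinset_card_le _).trans ?_
      cases Φ.gate v <;> simp [Gate.children]
    have h2 := Finset.card_insert_le o (ops ∪ ops.biUnion fun v => (Φ.gate v).children.toFinset)
    have h3 := Finset.card_union_le ops (ops.biUnion fun v => (Φ.gate v).children.toFinset)
    simp only [S]
    omega
  obtain ⟨L, hL, hlen, hmem⟩ := Φ.exists_isTopological S.card S rfl (by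
    intro v _ u hu
    refine Finset.mem_insert_of_mem (Finset.mem_union_right _ (Finset.mem_biUnion.2 ⟨v, ?_, ?_⟩))
    · simp only [ops, Finset.mem_filter, Finset.mem_univ, true_and]
      cases hg : Φ.gate v <;> simp [Edge, hg, Gate.children] at hu <;> trivial
    · exact List.mem_toFinset.2 hu)
  exact ⟨L, hL, (hmem o).2 (Finset.mem_insert_self _ _), hlen ▸ hS⟩

theorem MultiplicativelyDisjoint.exists_tree {F X : Type*} [Field F] {k : ℕ}
    {Φ : Circuit F (X ⊕ Fin k)} (hΦ : Φ.MultiplicativelyDisjoint)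
    {g : MvPolynomial (X ⊕ Fin k) F} (hg : Φ.Computes g) :
    ∃ (m : ℕ) (t : ArithTree F (X ⊕ Fin m)), boolSum (t.eval MvPolynomial.X) = boolSum g ∧
      t.ops ≤ (3 * Φ.size + 1) * (4 * (3 * Φ.size + 1) + 14) := by
  classical
  obtain ⟨o, rfl⟩ := hg
  obtain ⟨L, hL, ho, hlen⟩ := Φ.exists_topological_list o
  have hpos : 0 < 2 * L.length := by
    have := List.length_pos_of_mem ho
    omega
  obtain ⟨M, hM⟩ : ∃ M, M = 2 * L.length := ⟨_, rfl⟩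
  rw [← hM] at hpos
  -- Only the indices below `M` matter; the remainder makes the function total.
  let fbit : ℕ → Fin M := fun i => ⟨i % M, Nat.mod_lt _ hpos⟩
  let bit : ℕ → X ⊕ Fin (k + M) := (Sum.inr ∘ Fin.natAdd k) ∘ fbit
  let emb : X ⊕ Fin k → X ⊕ Fin (k + M) := Sum.map id (Fin.castAdd M)
  have hfinj : Set.InjOn fbit (Set.Iio (2 * L.length)) := by
    intro i hi j hj hij
    rw [← hM, Set.mem_Iio] at hi hj
    simpa [fbit, Nat.mod_eq_of_lt hi, Nat.mod_eq_of_lt hj] using hij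
  have hinj : Set.InjOn bit (Set.Iio (2 * L.length)) :=
    (Sum.inr_injective.comp (Fin.natAdd_injective M k)).comp_injOn hfinj
  have hemb : Function.Injective emb :=
    Function.Injective.sumMap Function.injective_id (Fin.castAdd_injective k M)
  have hne : ∀ z, ∀ i < 2 * L.length, emb z ≠ bit i := by
    rintro (x | j) i _ h
    · simp [emb, bit] at h
    · simp only [emb, bit, Sum.map_inr, Function.comp, Sum.inr.injEq, Fin.ext_iff,
        Fin.val_castAdd, Fin.val_natAdd] at h
      have := j.2
      omega
  -- At the start the parse tree consists of the output gate alone.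
  let c : Φ.V → ArithTree F (X ⊕ Fin (k + M)) := fun v => if v = o then .const 0 else .const 1
  let ρ₀ : X ⊕ Fin (k + M) → MvPolynomial X F := Sum.elim MvPolynomial.X 0
  have hinner : ∀ ρ : X ⊕ Fin (k + M) → MvPolynomial X F,
      listBoolSum (fun ρ => (Φ.parseTree emb bit L c).eval ρ) (bitList bit L.length) ρ =
        MvPolynomial.aeval (ρ ∘ emb) (Φ.value o) := by
    intro ρ
    have hc : ∀ (ρ : X ⊕ Fin (k + M) → MvPolynomial X F) v,
        (c v).eval ρ = if v ∈ ({o} : Finset Φ.V) then 0 else 1 := by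
      intro ρ v
      by_cases hv : v = o <;> simp [c, hv, ArithTree.eval]
    simp only [eval_parseTree, hc]
    refine (Φ.listBoolSum_parseValue emb bit hΦ L hL hinj hne {o} (by simpa using ho) (by simp) _
      (fun w _ => rfl) ρ).trans (Finset.prod_singleton _ _)
  let ys : List (Fin (k + M)) :=
    (List.finRange k).map (Fin.castAdd M) ++ (bitList fbit L.length).map (Fin.natAdd k)
  have hys : ys.Nodup := by
    refine List.Nodup.append ((List.nodup_finRange k).map (Fin.castAdd_injective k M))
      ((nodup_bitList fbit hfinj).map (Fin.natAdd_injective M k)) ?_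
    intro y h1 h2
    obtain ⟨i, -, rfl⟩ := List.mem_map.1 h1
    obtain ⟨j, -, h⟩ := List.mem_map.1 h2
    have := i.2
    simp only [Fin.ext_iff, Fin.val_castAdd, Fin.val_natAdd] at h
    omega
  have hmem : ∀ y, y ∈ ys := by
    intro y
    refine Fin.addCases (fun i => ?_) (fun i => ?_) y
    · simp [ys]
    · refine List.mem_append_right _ (List.mem_map.2 ⟨i, ?_, rfl⟩)
      rw [mem_bitList]
      exact ⟨i, hM ▸ i.2, by simp [fbit, Nat.mod_eq_of_lt i.2]⟩
  refine ⟨k + M, Φ.parseTree emb bit L c, ?_, ?_⟩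
  · have h1 := listBoolSum_eq_sum (fun ρ : X ⊕ Fin (k + M) → MvPolynomial X F =>
      (Φ.parseTree emb bit L c).eval ρ) hys hmem ρ₀
    have h2 := listBoolSum_eq_sum (fun ρ : X ⊕ Fin k → MvPolynomial X F =>
      MvPolynomial.aeval ρ (Φ.value o)) (List.nodup_finRange k) List.mem_finRange (ρ₀ ∘ emb)
    rw [boolSum_eval, boolSum]
    refine h1.symm.trans (Eq.trans ?_ h2)
    -- The inner sum over the edge bits collapses to the value at `o`; the outer one is the given
    -- sum over the `k` variables.
    rw [List.map_append, listBoolSum_append, List.map_map, List.map_map, ← bitList_comp,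
      ← listBoolSum_map hemb, List.map_map]
    exact listBoolSum_congr _ _ fun ρ _ => hinner ρ
  · refine (Φ.ops_parseTree_le emb bit L c 0 fun v => ?_).trans ?_
    · simp only [c]
      split <;> simp [ArithTree.ops]
    · refine Nat.mul_le_mul hlen ?_
      omega

end Circuit

/-! ### Polynomial bounds and the equality of the two forms of VNP. -/

theorem PolynomiallyBounded.comp_polynomial {t : ℕ → ℕ} (ht : PolynomiallyBounded t)
    (q : Polynomial ℕ) : PolynomiallyBounded fun n => q.eval (t n) := by
  obtain ⟨p, hp⟩ := ht
  refine ⟨q.comp p, fun n => ?_⟩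
  rw [Polynomial.eval_comp]
  simp only [Polynomial.eval_eq_sum, Polynomial.sum]
  refine Finset.sum_le_sum fun i _ => ?_
  gcongr
  simpa [Polynomial.eval_eq_sum, Polynomial.sum] using hp n

theorem PolynomiallyBounded.mono {t t' : ℕ → ℕ} (ht : PolynomiallyBounded t)
    (h : ∀ n, t' n ≤ t n) : PolynomiallyBounded t' := by
  obtain ⟨p, hp⟩ := ht
  exact ⟨p, fun n => (h n).trans (hp n)⟩

section Classes

variable (F : Type*) [Field F]

theorem VF_subset_VP : VF F ⊆ VP F := by
  rintro f ⟨Φ, hΦ, hs⟩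
  exact ⟨Φ, fun n => ⟨(hΦ n).1.multiplicativelyDisjoint, (hΦ n).2⟩, hs⟩

theorem VNP_eq_boolSumsOf_VF : VNP F = boolSumsOf (VF F) := by
  refine Set.Subset.antisymm ?_ ?_
  · rintro f ⟨k, g, ⟨Φ, hΦ, hs⟩, hf⟩
    choose m t ht hto using fun n => (hΦ n).1.exists_tree (hΦ n).2
    choose Ψ hΨ hΨc hΨs using fun n => (t n).exists_formula
    refine ⟨m, fun n => (t n).eval MvPolynomial.X, ⟨Ψ, fun n => ⟨hΨ n, hΨc n⟩, ?_⟩, fun n => ?_⟩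
    · refine (hs.comp_polynomial
        ((3 * Polynomial.X + 1) * (4 * (3 * Polynomial.X + 1) + 14))).mono fun n => ?_
      rw [hΨs]
      simpa using hto n
    · rw [hf, ht]
  · rintro f ⟨k, g, hg, hf⟩
    exact ⟨k, g, VF_subset_VP F hg, hf⟩

end Classes

/-! ### Ryser's formula and membership of the permanent in VNP. -/

/-- Ryser's formula. -/
theorem Matrix.permanent_eq_sum_fin_two {ι R : Type*} [Fintype ι] [DecidableEq ι] [CommRing R]
    (M : Matrix ι ι R) : M.permanent = ∑ e : ι → Fin 2,
      (∏ j, (-1 + 2 * if e j = 1 then 1 else 0)) * ∏ i, ∑ j, (if e j = 1 then 1 else 0) * M j i := by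
  have key : ∀ f : ι → ι, (∑ e : ι → Fin 2, (∏ j, (-1 + 2 * if e j = 1 then 1 else 0)) *
      ∏ i, (if e (f i) = 1 then (1 : R) else 0)) = if Function.Surjective f then 1 else 0 := by
    intro f
    -- Grouping by the fibres of `f` makes the sum over `e` a product over `j` of factors `1 - 0 ^
    -- |f⁻¹(j)|`, so a missed `j` kills it.
    have h1 : ∀ e : ι → Fin 2, ((∏ j, (-1 + 2 * if e j = 1 then 1 else 0)) *
        ∏ i, (if e (f i) = 1 then (1 : R) else 0)) =
        ∏ j, (-1 + 2 * if e j = 1 then 1 else 0) *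
          (if e j = 1 then (1 : R) else 0) ^ (Finset.univ.filter fun i => f i = j).card := by
      intro e
      rw [Finset.prod_mul_distrib, ← Finset.prod_fiberwise Finset.univ f fun i =>
        if e (f i) = 1 then (1 : R) else 0]
      congr 1
      refine Finset.prod_congr rfl fun j _ => Finset.prod_eq_pow_card fun i hi => ?_
      rw [(Finset.mem_filter.1 hi).2]
    simp only [h1]
    rw [← Fintype.prod_sum (fun j (x : Fin 2) => (-1 + 2 * if x = 1 then 1 else 0) *
      (if x = 1 then (1 : R) else 0) ^ (Finset.univ.filter fun i => f i = j).card)]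
    simp only [Fin.sum_univ_two]
    by_cases hf : Function.Surjective f
    · rw [if_pos hf]
      refine Finset.prod_eq_one fun j _ => ?_
      obtain ⟨i, hi⟩ := hf j
      have : (Finset.univ.filter fun i => f i = j).card ≠ 0 :=
        Finset.card_ne_zero_of_mem (a := i) (by simp [hi])
      simp [this]
      norm_num
    · rw [if_neg hf]
      simp only [Function.Surjective, not_forall, not_exists] at hf
      obtain ⟨j, hj⟩ := hf
      refine Finset.prod_eq_zero (Finset.mem_univ j) ?_
      simp [hj]
      norm_num
  have h2 : ∀ e : ι → Fin 2, ∏ i, ∑ j, (if e j = 1 then 1 else 0) * M j i =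
      ∑ f : ι → ι, (∏ i, if e (f i) = 1 then (1 : R) else 0) * ∏ i, M (f i) i := by
    intro e
    rw [Fintype.prod_sum]
    simp only [Finset.prod_mul_distrib]
  simp only [h2, Finset.mul_sum]
  rw [Finset.sum_comm]
  simp only [← mul_assoc, ← Finset.sum_mul, key]
  refine Finset.sum_of_injOn (fun σ : Equiv.Perm ι => (σ : ι → ι))
    (fun σ _ τ _ h => DFunLike.coe_injective h) (by simp) ?_ ?_
  · intro f _ hf
    rw [if_neg, zero_mul]
    intro hs
    exact hf ⟨Equiv.ofBijective f (Finite.injective_iff_bijective.1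
      (Finite.injective_iff_surjective.2 hs)), by simp, rfl⟩
  · intro σ _
    rw [if_pos σ.surjective, one_mul]

namespace ArithTree

variable {F Z R : Type*} [CommRing F] [CommRing R] [Algebra F R]

/-- The sum of a list of expressions. -/
def listSum (L : List (ArithTree F Z)) : ArithTree F Z := L.foldr add (const 0)

/-- The product of a list of expressions. -/
def listProd (L : List (ArithTree F Z)) : ArithTree F Z := L.foldr mul (const 1)

theorem eval_listSum (ρ : Z → R) (L : List (ArithTree F Z)) :
    (listSum L).eval ρ = (L.map (eval ρ)).sum := by
  induction L with
  | nil => simp [listSum, eval]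
  | cons t L ih => rw [List.map_cons, List.sum_cons, ← ih]; rfl

theorem eval_listProd (ρ : Z → R) (L : List (ArithTree F Z)) :
    (listProd L).eval ρ = (L.map (eval ρ)).prod := by
  induction L with
  | nil => simp [listProd, eval]
  | cons t L ih => rw [List.map_cons, List.prod_cons, ← ih]; rfl

theorem ops_listSum_le {b : ℕ} {L : List (ArithTree F Z)} (h : ∀ t ∈ L, t.ops ≤ b) :
    (listSum L).ops ≤ L.length * (b + 1) := by
  induction L with
  | nil => simp [listSum, ops]
  | cons t L ih =>
    have h1 := ih fun t ht => h t (by simp [ht])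
    have h2 := h t (by simp)
    have h3 : (listSum (t :: L)).ops = t.ops + (listSum L).ops + 1 := rfl
    rw [h3, List.length_cons, add_mul]
    omega

theorem ops_listProd_le {b : ℕ} {L : List (ArithTree F Z)} (h : ∀ t ∈ L, t.ops ≤ b) :
    (listProd L).ops ≤ L.length * (b + 1) := by
  induction L with
  | nil => simp [listProd, ops]
  | cons t L ih =>
    have h1 := ih fun t ht => h t (by simp [ht])
    have h2 := h t (by simp)
    have h3 : (listProd (t :: L)).ops = t.ops + (listProd L).ops + 1 := rfl
    rw [h3, List.length_cons, add_mul]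
    omega

variable (F) in
/-- Ryser's formula as an expression. -/
def ryser (n : ℕ) : ArithTree F ((Fin n × Fin n) ⊕ Fin n) :=
  mul (listProd ((List.finRange n).map fun j => add (const (-1)) (mul (const 2) (var (Sum.inr j)))))
    (listProd ((List.finRange n).map fun i => listSum ((List.finRange n).map fun j =>
      mul (var (Sum.inr j)) (var (Sum.inl (j, i))))))

theorem ops_ryser_le (n : ℕ) : (ryser F n).ops ≤ n * 3 + n * (n * 2 + 1) + 1 := by
  have h1 := ops_listProd_le (b := 2) (L := (List.finRange n).map fun j =>
    (add (const (-1)) (mul (const 2) (var (Sum.inr j))) : ArithTree F ((Fin n × Fin n) ⊕ Fin n)))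
    (by simp [ops])
  have h2 := ops_listProd_le (b := n * 2) (L := (List.finRange n).map fun i =>
      listSum ((List.finRange n).map fun j => (mul (var (Sum.inr j)) (var (Sum.inl (j, i))) :
        ArithTree F ((Fin n × Fin n) ⊕ Fin n)))) (by
    intro t ht
    obtain ⟨i, -, rfl⟩ := List.mem_map.1 ht
    refine (ops_listSum_le (b := 1) (by simp [ops])).trans ?_
    simp)
  simp only [List.length_map, List.length_finRange] at h1 h2
  rw [ryser, ops]
  omega

end ArithTree

theorem boolSum_ryser (F : Type*) [Field F] (n : ℕ) :
    boolSum ((ArithTree.ryser F n).eval MvPolynomial.X) =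
      (Matrix.mvPolynomialX (Fin n) (Fin n) F).permanent := by
  rw [boolSum_eval, Matrix.permanent_eq_sum_fin_two]
  refine Finset.sum_congr rfl fun e _ => ?_
  have hC : (MvPolynomial.C 2 : MvPolynomial (Fin n × Fin n) F) = 2 := map_ofNat _ 2
  simp [hC, ArithTree.ryser, ArithTree.eval, ArithTree.eval_listProd, ArithTree.eval_listSum,
    Function.comp_def, ← Fin.prod_univ_def, ← Fin.sum_univ_def]

theorem PER_mem_VNP (F : Type*) [Field F] : PER F ∈ VNP F := by
  rw [VNP_eq_boolSumsOf_VF]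
  choose Ψ hΨ hΨc hΨs using fun n => (ArithTree.ryser F n).exists_formula
  refine ⟨fun n => n, fun n => (ArithTree.ryser F n).eval MvPolynomial.X,
    ⟨Ψ, fun n => ⟨hΨ n, hΨc n⟩, ?_⟩, fun n => (boolSum_ryser F n).symm⟩
  refine ⟨Polynomial.X * 3 + Polynomial.X * (Polynomial.X * 2 + 1) + 1, fun n => ?_⟩
  refine (hΨs n).le.trans ?_
  simpa using ArithTree.ops_ryser_le n

theorem mainTheorem2 (F : Type*) [Field F] :
    (ringChar F ≠ 2 → IsCompleteFor (VNP F) (PER F)) ∧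
    (ringChar F ≠ 2 → ∀ (n m s : ℕ) (g : MvPolynomial (Fin n ⊕ Fin m) F),
      (∃ Φ : Circuit F (Fin n ⊕ Fin m), Φ.IsFormula ∧ Φ.Computes g ∧ Φ.size < s) →
        IsProjection (boolSum g) ((PER F).poly (6 * s))) ∧
    VNP F = boolSumsOf (VF F) := by
  refine ⟨fun h2 => ⟨PER_mem_VNP F, ?_⟩, fun h2 n m s g => ?_, VNP_eq_boolSumsOf_VF F⟩
  · rw [VNP_eq_boolSumsOf_VF]
    rintro f ⟨k, g, ⟨Φ, hΦ, p, hp⟩, hf⟩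
    -- The `+ 1` turns the bound on the size into a strict one.
    refine ⟨fun n => 6 * (p.eval n + 1), ⟨6 * (p + 1), fun n => by simp⟩, fun n => ?_⟩
    obtain ⟨t, ht, hto⟩ := (hΦ n).1.exists_tree (hΦ n).2
    have hg : boolSum (t.eval MvPolynomial.X) = f.poly n := by
      rw [ht, hf]
    rw [← hg]
    exact isProjection_permanent_of_tree (Ring.two_ne_zero h2) t
      (Nat.lt_succ_of_le (hto.trans (hp n)))
  · rintro ⟨Φ, hΦ, hg, hs⟩
    obtain ⟨t, rfl, hto⟩ := hΦ.exists_tree hg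
    exact isProjection_permanent_of_tree (Ring.two_ne_zero h2) t (hto.trans_lt hs)
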